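/- Let $\mathcal N\subset B(H)$ be a von Neumann algebra on a complex Hilbert space $H$, with a faithful normal semifinite trace $\tau$. For $A\in\mathcal N$ let $\mu(t,A)=\inf\{\|Ap\| : p\in\mathcal N \text{ a projection},\ \tau(1-p)\le t\}$, let $$\mathcal M_{1,\infty}=\Big\{A\in\mathcal N:\ \sup_{t>0}\frac1{\log(1+t)}\int_0^t\mu(s,A)\,ds<\infty\Big\},$$ let $\mathcal M_{1,\infty}^+$ be the set of positive operators in $\mathcal M_{1,\infty}$, and let $\mathcal L_1=\{X\in\mathcal N:\tau(|X|)<\infty\}$, to which $\tau$ is extended linearly. The Cesàro operator is $$(Mx)(t)=\frac1{\log t}\int_1^t x(s)\,\frac{ds}{s},\qquad t\in(0,\infty),\ t\neq1,$$ for functions $x$ on $(0,\infty)$ such that $x(s)/s$ is integrable between $1$ and $t$ for every $t>0$; the value of $Mx$ at the single point $t=1$ is immaterial and is set to $0$. $L_\infty(0,\infty)$ is the space of bounded Lebesgue measurable functions on $(0,\infty)$. Theorem. Let $f:[0,\infty)\to\mathbb C$ be a bounded function of class $C^2$ on $[0,\infty)$ (with one-sided derivatives at $0$) such that $f(0)=f'(0)=0$.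 Let $A\in\mathcal M^+_{1,\infty}$ and $B\in\mathcal N$. Then $f(tA)B\in\mathcal L_1$ for every $t>0$, the function $x(t)=\frac1t\tau(f(tA)B)$ lies in the domain of $M$ described above, and $$Mx=M\Big(t\mapsto\frac1t\tau(f(tA)B)\Big)\in L_\infty(0,\infty).$$ In this sense the generalised heat-kernel functional $\xi_{\omega,B,f}(A)=(\omega\circ M)\big(t\mapsto\frac1t\tau(f(tA)B)\big)$ is well defined for every linear functional $\omega$ on $L_\infty(0,\infty)$, in particular for every generalised limit: the trace is finite, $M$ can be applied to $x$, and $Mx$ lies in the domain of $\omega$. -/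

import Mathlib

open MeasureTheory Set
open scoped ENNReal ComplexStarModule

noncomputable section

/-- A faithful normal semifinite trace on a von Neumann algebra `N ⊆ B(H)`, given by its values
on the positive cone `N⁺ = {x ∈ N | 0 ≤ x}`; values of the function off the cone play no role. -/
structure FNSTrace {H : Type*} [NormedAddCommGroup H] [InnerProductSpace ℂ H] [CompleteSpace H]
    (N : VonNeumannAlgebra H) where
  toFun : (H →L[ℂ] H) → ℝ≥0∞
  add : ∀ x ∈ N, ∀ y ∈ N, 0 ≤ x → 0 ≤ y → toFun (x + y) = toFun x + toFun y
  smul : ∀ (c : ℝ), 0 ≤ c → ∀ x ∈ N, 0 ≤ x → toFun ((c : ℂ) • x) = ENNReal.ofReal c * toFun x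
  tracial : ∀ x ∈ N, toFun (star x * x) = toFun (x * star x)
  faithful : ∀ x ∈ N, 0 ≤ x → toFun x = 0 → x = 0
  normal : ∀ (S : Set (H →L[ℂ] H)) (x : H →L[ℂ] H), (∀ s ∈ S, s ∈ N ∧ 0 ≤ s) → x ∈ N →
    S.Nonempty → DirectedOn (· ≤ ·) S → IsLUB S x → toFun x = ⨆ s ∈ S, toFun s
  semifinite : ∀ x ∈ N, 0 ≤ x → x ≠ 0 → ∃ y ∈ N, 0 ≤ y ∧ y ≠ 0 ∧ y ≤ x ∧ toFun y < ∞

namespace FNSTrace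

variable {H : Type*} [NormedAddCommGroup H] [InnerProductSpace ℂ H] [CompleteSpace H]
  {N : VonNeumannAlgebra H}

/-- The ideal `𝓛₁(N, τ)`: the operators `x ∈ N` with `τ(|x|) < ∞`. -/
def L1 (τ : FNSTrace N) : Set (H →L[ℂ] H) :=
  {x | x ∈ N ∧ τ.toFun (CFC.abs x) < ∞}

/-- The linear extension of `τ` to `𝓛₁(N, τ)`, through the decomposition
`x = (Re x)₊ - (Re x)₋ + i ((Im x)₊ - (Im x)₋)`. It is meaningful for `x ∈ 𝓛₁(N, τ)`. -/
def tr (τ : FNSTrace N) (x : H →L[ℂ] H) : ℂ :=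
  (((τ.toFun ((ℜ x : H →L[ℂ] H)⁺)).toReal - (τ.toFun ((ℜ x : H →L[ℂ] H)⁻)).toReal : ℝ) : ℂ) +
    Complex.I *
      (((τ.toFun ((ℑ x : H →L[ℂ] H)⁺)).toReal - (τ.toFun ((ℑ x : H →L[ℂ] H)⁻)).toReal : ℝ) : ℂ)

/-- The generalised singular value function
`μ(t, A) = inf {‖A p‖ : p a projection in N, τ(1 - p) ≤ t}`. -/
def singularValue (τ : FNSTrace N) (t : ℝ) (A : H →L[ℂ] H) : ℝ :=
  sInf {r : ℝ | ∃ p ∈ N, IsStarProjection p ∧ τ.toFun (1 - p) ≤ ENNReal.ofReal t ∧ r = ‖A * p‖}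

/-- The Marcinkiewicz operator space `𝓜_{1,∞}(N, τ)`: the operators `A ∈ N` with
`sup_{t > 0} (1 / log (1 + t)) ∫₀ᵗ μ(s, A) ds < ∞`. -/
def M1Infty (τ : FNSTrace N) : Set (H →L[ℂ] H) :=
  {A | A ∈ N ∧ BddAbove
    ((fun t : ℝ ↦ (1 / Real.log (1 + t)) * ∫ s in (0 : ℝ)..t, τ.singularValue s A) '' Ioi 0)}

end FNSTrace

/-- `f(A)` for a self-adjoint operator `A` and a complex function `f` of a real variable that is
continuous on the spectrum of `A`, by the continuous functional calculus. -/
def opFun {H : Type*} [NormedAddCommGroup H] [InnerProductSpace ℂ H] [CompleteSpace H]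
    (f : ℝ → ℂ) (A : H →L[ℂ] H) : H →L[ℂ] H :=
  cfc (fun z : ℂ ↦ f z.re) A

/-- `t ↦ (1/t) τ(f(tA)B)`. -/
def heatFun {H : Type*} [NormedAddCommGroup H] [InnerProductSpace ℂ H] [CompleteSpace H]
    {N : VonNeumannAlgebra H} (τ : FNSTrace N) (f : ℝ → ℂ) (A B : H →L[ℂ] H) (t : ℝ) : ℂ :=
  (1 / (t : ℂ)) * τ.tr (opFun f ((t : ℂ) • A) * B)

/-- The functions `x` on `(0,∞)` to which the Cesàro operator applies:
`s ↦ x(s)/s` is integrable between `1` and any `t > 0`. -/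
def CesaroDomain (x : ℝ → ℂ) : Prop :=
  ∀ t : ℝ, 0 < t → IntervalIntegrable (fun s ↦ x s / (s : ℂ)) volume 1 t

/-- The Cesàro operator `(Mx)(t) = (1 / log t) ∫₁ᵗ x(s) ds/s` on functions on `(0,∞)`
(at the single point `t = 1` the quotient is read as `0`). -/
def cesaro (x : ℝ → ℂ) (t : ℝ) : ℂ :=
  (1 / (Real.log t : ℂ)) * ∫ s in (1 : ℝ)..t, x s / (s : ℂ)

/-- `L_∞(0,∞)`: the bounded Lebesgue measurable functions on `(0,∞)`. -/
def LInfty : Set (ℝ → ℂ) :=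
  {x | AEStronglyMeasurable x (volume.restrict (Ioi 0)) ∧ ∃ K : ℝ, ∀ t : ℝ, 0 < t → ‖x t‖ ≤ K}

end

/-! Since `f` is bounded, C² and vanishes to second order at 0, |f(x)| ≤ C min(1, x²) on [0,∞).
Hence |τ(f(sA)B)| is at most a constant times τ(min(1, s²A²)) (`opFun_mul_estimate`), and it remains
to show that the integral of s⁻² τ(min(1, s²A²)) over [1, t] is O(log t).

Let n_k be the trace of the square of a continuous cutoff of `A` at height about 2⁻ᵏ. A projection
`p` with ‖Ap‖ < 2⁻ᵏ⁻¹ must satisfy τ(1 - p) ≥ ¾ n_k, so μ(u, A) ≥ 2⁻ᵏ⁻¹ for u < ¾ n_k. Fed into the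
Marcinkiewicz condition, this first bounds n_k by a multiple of 4ᵏ, so log(1 + n_k) = O(k + 1).
Summation by parts then gives ∑_{k ≤ K} n_k 2⁻ᵏ = O(K + 1) (`exists_dyadicTrace_bound`). A
layer-cake bound dominates min(1, s²x²) by 16 ∑ min(1, s²/4ᵏ) times the squared cutoffs. The weight
min(1, s²/4ᵏ)/s² has integral O(2⁻ᵏ), so layers up to L ≈ log₂ t contribute O(L) and the remaining
ones also O(L).

Near t = 1 and near 0 the integrand is bounded, because τ(A²) < ∞, and |t - 1| ≤ 2|log t| suffices.
Continuity in s gives integrability and measurability. Spectral projections and polar decompositions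
are replaced throughout by continuous functional calculus, with normality of τ removing an ε. -/

/-! ### Stability of a von Neumann algebra under functional calculus -/

namespace VonNeumannAlgebra

variable {H : Type*} [NormedAddCommGroup H] [InnerProductSpace ℂ H] [CompleteSpace H]
  {N : VonNeumannAlgebra H}

/-- The algebra equals its double commutant, and centralizers are norm closed. Norm closedness is
all that continuous functional calculus needs to stay in `N`. -/
theorem isClosed_coe (N : VonNeumannAlgebra H) :
    IsClosed (N.toStarSubalgebra : Set (H →L[ℂ] H)) := by
  rw [coe_toStarSubalgebra, ← N.centralizer_centralizer]
  exact Set.isClosed_centralizer _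

theorem smul_mem (c : ℂ) {x : H →L[ℂ] H} (hx : x ∈ N) : c • x ∈ N :=
  N.toStarSubalgebra.smul_mem hx c

theorem real_smul_mem (c : ℝ) {x : H →L[ℂ] H} (hx : x ∈ N) : c • x ∈ N := by
  have := smul_mem (N := N) (c : ℂ) hx
  rwa [Complex.coe_smul] at this

theorem cfc_complex_mem {x : H →L[ℂ] H} (hx : x ∈ N) (f : ℂ → ℂ) : cfc f x ∈ N :=
  StarAlgebra.elemental.le_of_mem N.isClosed_coe hx (cfc_mem_elemental f x)

theorem cfc_real_mem {x : H →L[ℂ] H} (hx : x ∈ N) (f : ℝ → ℝ) : cfc f x ∈ N := by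
  by_cases h : IsSelfAdjoint x
  · rw [cfc_real_eq_complex f h]
    exact cfc_complex_mem hx _
  · rw [cfc_apply_of_not_predicate x h]
    exact zero_mem N

theorem cfcₙ_real_mem {x : H →L[ℂ] H} (hx : x ∈ N) (f : ℝ → ℝ) : cfcₙ f x ∈ N := by
  by_cases h : ContinuousOn f (quasispectrum ℝ x)
  · by_cases h0 : f 0 = 0
    · rw [cfcₙ_eq_cfc h h0]
      exact cfc_real_mem hx f
    · rw [cfcₙ_apply_of_not_map_zero x h0]
      exact zero_mem N
  · rw [cfcₙ_apply_of_not_continuousOn x h]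
    exact zero_mem N

theorem posPart_mem {x : H →L[ℂ] H} (hx : x ∈ N) : x⁺ ∈ N := cfcₙ_real_mem hx _

theorem negPart_mem {x : H →L[ℂ] H} (hx : x ∈ N) : x⁻ ∈ N := cfcₙ_real_mem hx _

theorem sqrt_mem {x : H →L[ℂ] H} (hx : x ∈ N) (h0 : 0 ≤ x) : CFC.sqrt x ∈ N := by
  rw [CFC.sqrt_eq_real_sqrt x h0]
  exact cfcₙ_real_mem hx _

theorem abs_mem {x : H →L[ℂ] H} (hx : x ∈ N) : CFC.abs x ∈ N :=
  sqrt_mem (mul_mem (star_mem hx) hx) (star_mul_self_nonneg x)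

theorem realPart_mem {x : H →L[ℂ] H} (hx : x ∈ N) : (ℜ x : H →L[ℂ] H) ∈ N := by
  rw [realPart_apply_coe]
  exact real_smul_mem _ (add_mem hx (star_mem hx))

theorem imaginaryPart_mem {x : H →L[ℂ] H} (hx : x ∈ N) : (ℑ x : H →L[ℂ] H) ∈ N := by
  rw [imaginaryPart_apply_coe]
  exact smul_mem _ (real_smul_mem _ (sub_mem hx (star_mem hx)))

end VonNeumannAlgebra

open VonNeumannAlgebra

/-! ### Trace inequalities on the positive cone -/

namespace FNSTrace

variable {H : Type*} [NormedAddCommGroup H] [InnerProductSpace ℂ H] [CompleteSpace H]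
  {N : VonNeumannAlgebra H} (τ : FNSTrace N)

theorem toFun_zero : τ.toFun 0 = 0 := by
  simpa using τ.smul 0 le_rfl 0 (zero_mem N) le_rfl

theorem toFun_real_smul {c : ℝ} (hc : 0 ≤ c) {x : H →L[ℂ] H} (hx : x ∈ N) (h0 : 0 ≤ x) :
    τ.toFun (c • x) = ENNReal.ofReal c * τ.toFun x := by
  rw [← τ.smul c hc x hx h0, Complex.coe_smul]

theorem toFun_mono {x y : H →L[ℂ] H} (hx : x ∈ N) (hy : y ∈ N) (h0 : 0 ≤ x) (h : x ≤ y) :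
    τ.toFun x ≤ τ.toFun y := by
  have := τ.add x hx (y - x) (sub_mem hy hx) h0 (sub_nonneg.2 h)
  rw [add_sub_cancel] at this
  rw [this]
  exact le_self_add

theorem toFun_sum {ι : Type*} (s : Finset ι) (x : ι → H →L[ℂ] H) (hx : ∀ i ∈ s, x i ∈ N)
    (h0 : ∀ i ∈ s, 0 ≤ x i) : τ.toFun (∑ i ∈ s, x i) = ∑ i ∈ s, τ.toFun (x i) := by
  classical
  induction s using Finset.induction_on with
  | empty => simpa using τ.toFun_zero
  | insert i s hi ih =>
    rw [Finset.sum_insert hi, Finset.sum_insert hi,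
      τ.add _ (hx _ (Finset.mem_insert_self _ _)) _
        (sum_mem fun j hj ↦ hx j (Finset.mem_insert_of_mem hj))
        (h0 _ (Finset.mem_insert_self _ _))
        (Finset.sum_nonneg fun j hj ↦ h0 j (Finset.mem_insert_of_mem hj)),
      ih (fun j hj ↦ hx j (Finset.mem_insert_of_mem hj))
        (fun j hj ↦ h0 j (Finset.mem_insert_of_mem hj))]

/-- `τ(c* z c) ≤ ‖c‖² τ(z)` for `z ≥ 0`. -/
theorem toFun_conj_le {z c : H →L[ℂ] H} (hz : z ∈ N) (hc : c ∈ N) (h0 : 0 ≤ z) :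
    τ.toFun (star c * z * c) ≤ ENNReal.ofReal (‖c‖ ^ 2) * τ.toFun z := by
  set w := CFC.sqrt z with hw
  have hwN : w ∈ N := sqrt_mem hz h0
  have hws : star w = w := (CFC.sqrt_nonneg z).isSelfAdjoint
  have hww : w * w = z := CFC.sqrt_mul_sqrt_self z h0
  have e1 : star c * z * c = star (w * c) * (w * c) := by
    rw [star_mul, hws, ← hww]; simp only [mul_assoc]
  have e2 : w * c * star (w * c) = star w * (c * star c) * w := by
    rw [star_mul, hws]; simp only [mul_assoc]
  rw [e1, τ.tracial _ (mul_mem hwN hc), ← τ.toFun_real_smul (by positivity) hz h0]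
  refine τ.toFun_mono (mul_mem (mul_mem hwN hc) (star_mem (mul_mem hwN hc)))
    (real_smul_mem _ hz) (mul_star_self_nonneg _) ?_
  rw [e2]
  refine (star_left_conjugate_le_conjugate CStarAlgebra.mul_star_le_algebraMap_norm_sq w).trans
    (le_of_eq ?_)
  rw [hws, Algebra.algebraMap_eq_smul_one, mul_smul_comm, mul_one, smul_mul_assoc, hww]

theorem toFun_conj_le_of_norm_le_one {z c : H →L[ℂ] H} (hz : z ∈ N) (hc : c ∈ N) (h0 : 0 ≤ z)
    (h1 : ‖c‖ ≤ 1) : τ.toFun (star c * z * c) ≤ τ.toFun z := by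
  refine (τ.toFun_conj_le hz hc h0).trans ?_
  have : ENNReal.ofReal (‖c‖ ^ 2) ≤ 1 := by
    rw [ENNReal.ofReal_le_one]
    exact pow_le_one₀ (norm_nonneg _) h1
  exact mul_le_of_le_one_left (zero_le) this

/-- A consequence of normality: `τ(x)` is controlled by the traces of `(x - ε)₊`. -/
theorem toFun_le_of_forall_pos {x : H →L[ℂ] H} (hx : x ∈ N) (h0 : 0 ≤ x) {c : ℝ≥0∞}
    (h : ∀ ε : ℝ, 0 < ε → τ.toFun (cfc (fun t : ℝ ↦ max (t - ε) 0) x) ≤ c) :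
    τ.toFun x ≤ c := by
  have hsa : IsSelfAdjoint x := h0.isSelfAdjoint
  have key := τ.normal ((fun ε : ℝ ↦ cfc (fun t : ℝ ↦ max (t - ε) 0) x) '' Ioi 0) x ?_ hx ?_ ?_ ?_
  · rw [key]
    simp only [mem_image, iSup_exists, iSup_le_iff]
    rintro s ε ⟨hε, rfl⟩
    exact h ε hε
  · rintro _ ⟨ε, -, rfl⟩
    exact ⟨cfc_real_mem hx _, cfc_nonneg fun t _ ↦ le_max_right _ _⟩
  · exact ⟨_, 1, mem_Ioi.2 one_pos, rfl⟩
  · rintro _ ⟨a, ha, rfl⟩ _ ⟨b, hb, rfl⟩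
    refine ⟨_, ⟨min a b, mem_Ioi.2 (lt_min ha hb), rfl⟩, ?_, ?_⟩
    · exact cfc_mono fun t _ ↦ max_le_max_right _ (by linarith [min_le_left a b])
    · exact cfc_mono fun t _ ↦ max_le_max_right _ (by linarith [min_le_right a b])
  · constructor
    · rintro _ ⟨ε, hε, rfl⟩
      conv_rhs => rw [← cfc_id ℝ x]
      refine cfc_mono fun t ht ↦ max_le ?_ ?_
      · have : (0 : ℝ) < ε := hε
        simp only [id]; linarith
      · exact spectrum_nonneg_of_nonneg h0 ht
    · intro u hu
      -- An upper bound u of all (x - ε)₊ satisfies x - ε ≤ (x - ε)₊ ≤ u; then ε tends to 0 in norm.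
      have hle : ∀ ε ∈ Ioi (0 : ℝ), x ≤ u + algebraMap ℝ _ ε := by
        intro ε hε
        have h1 := hu ⟨ε, hε, rfl⟩
        rw [← sub_le_iff_le_add]
        refine le_trans ?_ h1
        conv_lhs => rw [← cfc_id ℝ x, ← cfc_const ε x, ← cfc_sub id (fun _ ↦ ε) x]
        exact cfc_mono fun t _ ↦ le_max_left _ _
      have ht : Filter.Tendsto (fun ε : ℝ ↦ u + algebraMap ℝ (H →L[ℂ] H) ε)
          (nhdsWithin 0 (Ioi 0)) (nhds (u + algebraMap ℝ _ 0)) := by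
        refine Filter.Tendsto.mono_left ?_ nhdsWithin_le_nhds
        exact (continuous_const.add (continuous_algebraMap ℝ _)).tendsto 0
      rw [map_zero, add_zero] at ht
      exact ge_of_tendsto ht (Filter.eventually_of_mem self_mem_nhdsWithin hle)

/-- If `y ≤ z` with `y` self-adjoint and `z ≥ 0`, then `τ(y₊) ≤ τ(z)`. -/
theorem toFun_posPart_le {y z : H →L[ℂ] H} (hy : y ∈ N) (hz : z ∈ N) (hsa : IsSelfAdjoint y)
    (h0 : 0 ≤ z) (h : y ≤ z) : τ.toFun y⁺ ≤ τ.toFun z := by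
  refine τ.toFun_le_of_forall_pos (posPart_mem hy) (CFC.posPart_nonneg y) fun ε hε ↦ ?_
  -- In general y ≤ z does not imply y₊ ≤ z, so the inequality is compressed by the contraction G =
  -- g(y), a continuous stand-in for the projection onto y > 0. The shift ε/2 makes t³/(t + ε/2)² ≥
  -- t - ε for t ≥ 0: the t² terms cancel.
  set g : ℝ → ℝ := fun t ↦ max t 0 / (max t 0 + ε / 2) with hg
  have hpos : ∀ t : ℝ, 0 < max t 0 + ε / 2 := fun t ↦ by
    have := le_max_right t 0; linarith
  have hgc : Continuous g := by
    refine Continuous.div (by fun_prop) (by fun_prop) fun t ↦ (hpos t).ne'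
  have hg0 : ∀ t, 0 ≤ g t := fun t ↦ div_nonneg (le_max_right _ _) (hpos t).le
  have hg1 : ∀ t, g t ≤ 1 := fun t ↦ (div_le_one (hpos t)).2 (by linarith)
  set G := cfc g y with hG
  have hGs : star G = G := IsSelfAdjoint.cfc
  have hGn : ‖G‖ ≤ 1 := norm_cfc_le zero_le_one fun t _ ↦ by
    rw [Real.norm_of_nonneg (hg0 t)]; exact hg1 t
  have hGN : G ∈ N := cfc_real_mem hy g
  refine le_trans ?_ (τ.toFun_conj_le_of_norm_le_one hz hGN h0 hGn)
  refine τ.toFun_mono (cfc_real_mem (posPart_mem hy) _) (mul_mem (mul_mem (star_mem hGN) hz) hGN)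
    (cfc_nonneg fun t _ ↦ le_max_right _ _) ?_
  refine le_trans ?_ (star_left_conjugate_le_conjugate h G)
  have e1 : star G * y * G = cfc (fun t ↦ g t * t * g t) y := by
    rw [hGs, cfc_mul (fun t ↦ g t * t) g y (by fun_prop) (by fun_prop),
      cfc_mul g (fun t ↦ t) y (by fun_prop) (by fun_prop), cfc_id' ℝ y]
  have e2 : y⁺ = cfc (fun t : ℝ ↦ max t 0) y := by
    rw [CFC.posPart_def, cfcₙ_eq_cfc (by fun_prop) (by simp)]; rfl
  rw [e1, e2, ← cfc_comp' (fun t : ℝ ↦ max (t - ε) 0) (fun t : ℝ ↦ max t 0) y]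
  refine cfc_mono (fun t _ ↦ ?_) (by fun_prop) (by fun_prop)
  rcases le_total t 0 with ht | ht
  · simp [hg, max_eq_right ht, hε.le]
  · have hp := hpos t
    simp only [hg, max_eq_left ht] at hp ⊢
    refine max_le ?_ (by positivity)
    rw [div_mul_eq_mul_div, div_mul_div_comm, le_div_iff₀ (by positivity)]
    nlinarith [mul_nonneg ht (sq_nonneg ε), pow_pos hε 3]

/-- The trace norm of a product of two Hilbert--Schmidt operators. -/
theorem toFun_abs_mul_le {p q : H →L[ℂ] H} (hp : p ∈ N) (hq : q ∈ N) (hps : star p = p) :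
    2 * τ.toFun (CFC.abs (p * q)) ≤ τ.toFun (p * p) + τ.toFun (star q * q) := by
  set y := p * q with hy
  have hyN : y ∈ N := mul_mem hp hq
  set a := CFC.abs y with ha
  have ha0 : 0 ≤ a := CFC.abs_nonneg y
  have hasa : IsSelfAdjoint a := ha0.isSelfAdjoint
  have haN : a ∈ N := abs_mem hyN
  suffices h : τ.toFun a ≤ (τ.toFun (p * p) + τ.toFun (star q * q)) / 2 by
    rw [ENNReal.le_div_iff_mul_le (by simp) (by simp), mul_comm] at h
    exact h
  refine τ.toFun_le_of_forall_pos haN ha0 fun ε hε ↦ ?_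
  rw [ENNReal.le_div_iff_mul_le (by simp) (by simp), mul_comm]
  have hsp : ∀ t ∈ spectrum ℝ a, 0 ≤ t := fun t ht ↦ spectrum_nonneg_of_nonneg ha0 ht
  -- The contraction v = y(|y| + ε)⁻¹ replaces the partial isometry of the polar decomposition: v*y
  -- = |y|²/(|y| + ε) ≥ (|y| - ε)₊.
  set g : ℝ → ℝ := fun t ↦ 1 / (t + ε) with hg
  have hgc : ContinuousOn g (spectrum ℝ a) := by
    refine ContinuousOn.div (by fun_prop) (by fun_prop) fun t ht ↦ ?_
    have := hsp t ht; positivity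
  set G := cfc g a with hG
  have hGs : star G = G := IsSelfAdjoint.cfc
  have hGN : G ∈ N := cfc_real_mem haN g
  set v := y * G with hv
  have hvN : v ∈ N := mul_mem hyN hGN
  have hyy : star y * y = a * a := (CFC.abs_mul_abs y).symm
  have e0 : G * (a * a) = cfc (fun t ↦ g t * (t * t)) a := by
    rw [cfc_mul g (fun t ↦ t * t) a hgc (by fun_prop),
      cfc_mul (fun t ↦ t) (fun t ↦ t) a (by fun_prop) (by fun_prop), cfc_id' ℝ a]
  have e1 : star v * y = cfc (fun t ↦ g t * (t * t)) a := by
    rw [hv, star_mul, hGs, mul_assoc, hyy, e0]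
  have hvn : ‖v‖ ≤ 1 := by
    have : ‖star v * v‖ ≤ 1 := by
      have e3 : star v * v = cfc (fun t ↦ g t * (t * t) * g t) a := by
        rw [cfc_mul _ g a (by fun_prop) hgc, ← e1, mul_assoc]
      rw [e3]
      refine norm_cfc_le zero_le_one fun t ht ↦ ?_
      have := hsp t ht
      rw [Real.norm_of_nonneg (by positivity)]
      simp only [hg]
      rw [div_mul_eq_mul_div, div_mul_div_comm, div_le_one (by positivity)]
      nlinarith
    rw [CStarRing.norm_star_mul_self] at this
    nlinarith [norm_nonneg v]
  have hle : cfc (fun t : ℝ ↦ max (t - ε) 0) a ≤ star v * y := by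
    rw [e1]
    refine cfc_mono (fun t ht ↦ ?_) (by fun_prop) (by fun_prop)
    have := hsp t ht
    refine max_le ?_ (by positivity)
    simp only [hg]
    rw [div_mul_eq_mul_div, le_div_iff₀ (by positivity)]
    nlinarith [sq_nonneg ε]
  -- Expansion of (pv - q)*(pv - q) ≥ 0; both cross terms equal v*y because v*y is self-adjoint.
  have hsum : star v * y + star v * y ≤ star v * (p * p) * v + star q * q := by
    have hs : star (star v * y) = star v * y := by
      rw [e1]; exact IsSelfAdjoint.cfc
    have hs' : star q * (p * v) = star v * (p * q) := by
      rw [← hs, hy]; simp only [star_mul, star_star, hps, mul_assoc]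
    have := star_mul_self_nonneg (p * v - q)
    have e4 : star (p * v - q) * (p * v - q) =
        star v * (p * p) * v + star q * q - (star v * y + star v * y) := by
      rw [star_sub, star_mul, hps, sub_mul, mul_sub, mul_sub, hs', hy]
      simp only [mul_assoc]
      abel
    rw [e4] at this
    exact sub_nonneg.1 this
  set T := cfc (fun t : ℝ ↦ max (t - ε) 0) a with hT
  have hTN : T ∈ N := cfc_real_mem haN _
  have hT0 : 0 ≤ T := cfc_nonneg fun t _ ↦ le_max_right _ _
  have hpp : 0 ≤ p * p := by
    have := star_mul_self_nonneg p
    rwa [hps] at this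
  have hvpN : star v * (p * p) * v ∈ N :=
    mul_mem (mul_mem (star_mem hvN) (mul_mem hp hp)) hvN
  have hqq : star q * q ∈ N := mul_mem (star_mem hq) hq
  rw [two_mul, ← τ.add T hTN T hTN hT0 hT0]
  refine (τ.toFun_mono (add_mem hTN hTN) (add_mem hvpN hqq) (add_nonneg hT0 hT0)
    ((add_le_add hle hle).trans hsum)).trans ?_
  rw [τ.add _ hvpN _ hqq (star_left_conjugate_nonneg hpp v) (star_mul_self_nonneg q)]
  gcongr
  exact τ.toFun_conj_le_of_norm_le_one (mul_mem hp hp) hvN hpp hvn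

end FNSTrace

/-! ### Functional calculus for complex functions of a real variable -/

section OpFun

variable {H : Type*} [NormedAddCommGroup H] [InnerProductSpace ℂ H] [CompleteSpace H]

theorem IsSelfAdjoint.re_mem_spectrum_real {A : H →L[ℂ] H} (hA : IsSelfAdjoint A) {z : ℂ}
    (hz : z ∈ spectrum ℂ A) : z.re ∈ spectrum ℝ A := by
  rw [← hA.spectrumRestricts.algebraMap_image] at hz
  obtain ⟨x, hx, rfl⟩ := hz
  simpa using hx

theorem continuousOn_comp_re {A : H →L[ℂ] H} (hA : IsSelfAdjoint A) {f : ℝ → ℂ}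
    (hf : ContinuousOn f (spectrum ℝ A)) : ContinuousOn (fun z : ℂ ↦ f z.re) (spectrum ℂ A) :=
  hf.comp Complex.continuous_re.continuousOn fun _ hz ↦ hA.re_mem_spectrum_real hz

theorem opFun_mul {A : H →L[ℂ] H} (hA : IsSelfAdjoint A) {f g : ℝ → ℂ}
    (hf : ContinuousOn f (spectrum ℝ A)) (hg : ContinuousOn g (spectrum ℝ A)) :
    opFun (fun x ↦ f x * g x) A = opFun f A * opFun g A :=
  cfc_mul _ _ A (continuousOn_comp_re hA hf) (continuousOn_comp_re hA hg)

theorem opFun_sub {A : H →L[ℂ] H} (hA : IsSelfAdjoint A) {f g : ℝ → ℂ}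
    (hf : ContinuousOn f (spectrum ℝ A)) (hg : ContinuousOn g (spectrum ℝ A)) :
    opFun (fun x ↦ f x - g x) A = opFun f A - opFun g A :=
  cfc_sub _ _ A (continuousOn_comp_re hA hf) (continuousOn_comp_re hA hg)

theorem star_opFun (A : H →L[ℂ] H) (f : ℝ → ℂ) :
    star (opFun f A) = opFun (fun x ↦ star (f x)) A :=
  (cfc_star _ A).symm

theorem opFun_ofReal {A : H →L[ℂ] H} (hA : IsSelfAdjoint A) (f : ℝ → ℝ) :
    opFun (fun x ↦ (f x : ℂ)) A = cfc f A :=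
  (cfc_real_eq_complex f hA).symm

theorem opFun_smul {A : H →L[ℂ] H} (hA : IsSelfAdjoint A) (t : ℝ) {f : ℝ → ℂ}
    (hf : ContinuousOn f ((fun x ↦ t * x) '' spectrum ℝ A)) :
    opFun f ((t : ℂ) • A) = opFun (fun x ↦ f (t * x)) A := by
  have h := cfc_comp_const_mul (t : ℂ) (fun z : ℂ ↦ f z.re) A ?_ hA.isStarNormal
  · rw [opFun, ← h, opFun]
    simp only [Complex.re_ofReal_mul]
  · refine hf.comp Complex.continuous_re.continuousOn ?_
    rintro _ ⟨z, hz, rfl⟩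
    exact ⟨z.re, hA.re_mem_spectrum_real hz, by simp⟩

theorem opFun_mem {N : VonNeumannAlgebra H} {A : H →L[ℂ] H} (hA : A ∈ N) (f : ℝ → ℂ) :
    opFun f A ∈ N := cfc_complex_mem hA _

end OpFun

/-! ### The linear extension of the trace and the trace-class estimate -/

namespace FNSTrace

variable {H : Type*} [NormedAddCommGroup H] [InnerProductSpace ℂ H] [CompleteSpace H]
  {N : VonNeumannAlgebra H} (τ : FNSTrace N)

/-- The linear extension of `τ` to self-adjoint operators. -/
noncomputable def trSA (y : H →L[ℂ] H) : ℝ := (τ.toFun y⁺).toReal - (τ.toFun y⁻).toReal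

/-- The positive and negative parts of `y` have finite trace. -/
def FiniteParts (y : H →L[ℂ] H) : Prop := τ.toFun y⁺ < ∞ ∧ τ.toFun y⁻ < ∞

theorem tr_eq (x : H →L[ℂ] H) :
    τ.tr x = (τ.trSA (ℜ x : H →L[ℂ] H) : ℂ) + Complex.I * (τ.trSA (ℑ x : H →L[ℂ] H) : ℂ) := rfl

variable {τ}

theorem FiniteParts.sub {y z : H →L[ℂ] H} (hy : y ∈ N) (hz : z ∈ N) (hys : IsSelfAdjoint y)
    (hzs : IsSelfAdjoint z) (hyf : τ.FiniteParts y) (hzf : τ.FiniteParts z) :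
    τ.FiniteParts (y - z) := by
  have aux : ∀ {y z : H →L[ℂ] H}, y ∈ N → z ∈ N → IsSelfAdjoint y → IsSelfAdjoint z →
      τ.FiniteParts y → τ.FiniteParts z → τ.toFun (y - z)⁺ < ∞ := by
    intro y z hy hz hys hzs hyf hzf
    refine (τ.toFun_posPart_le (z := y⁺ + z⁻) (sub_mem hy hz)
      (add_mem (posPart_mem hy) (negPart_mem hz)) (hys.sub hzs)
      (add_nonneg (CFC.posPart_nonneg y) (CFC.negPart_nonneg z)) ?_).trans_lt ?_
    · rw [sub_eq_add_neg]
      exact add_le_add (CFC.le_posPart hys) (neg_le.1 (CFC.neg_negPart_le hzs))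
    · rw [τ.add _ (posPart_mem hy) _ (negPart_mem hz) (CFC.posPart_nonneg y)
        (CFC.negPart_nonneg z)]
      exact ENNReal.add_lt_top.2 ⟨hyf.1, hzf.2⟩
  refine ⟨aux hy hz hys hzs hyf hzf, ?_⟩
  rw [← CFC.posPart_neg, neg_sub]
  exact aux hz hy hzs hys hzf hyf

/-- Moving negative parts across turns the decomposition of y - z into an identity between sums of
positive operators, where additivity of τ applies; finiteness allows subtracting afterwards. -/
theorem trSA_sub {y z : H →L[ℂ] H} (hy : y ∈ N) (hz : z ∈ N) (hys : IsSelfAdjoint y)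
    (hzs : IsSelfAdjoint z) (hyf : τ.FiniteParts y) (hzf : τ.FiniteParts z) :
    τ.trSA (y - z) = τ.trSA y - τ.trSA z := by
  have hf := FiniteParts.sub hy hz hys hzs hyf hzf
  have hd : y - z ∈ N := sub_mem hy hz
  have e1 : (y - z)⁺ + y⁻ + z⁺ = (y - z)⁻ + y⁺ + z⁻ := by
    have h1 := CFC.posPart_sub_negPart y hys
    have h2 := CFC.posPart_sub_negPart z hzs
    have h3 := CFC.posPart_sub_negPart (y - z) (hys.sub hzs)
    rw [sub_eq_iff_eq_add] at h1 h2 h3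
    rw [h1, h2, h3]
    abel
  have e2 := congrArg τ.toFun e1
  have p := fun x : H →L[ℂ] H ↦ CFC.posPart_nonneg x
  have n := fun x : H →L[ℂ] H ↦ CFC.negPart_nonneg x
  rw [τ.add _ (add_mem (posPart_mem hd) (negPart_mem hy)) _ (posPart_mem hz)
      (add_nonneg (p _) (n _)) (p _), τ.add _ (posPart_mem hd) _ (negPart_mem hy) (p _) (n _),
    τ.add _ (add_mem (negPart_mem hd) (posPart_mem hy)) _ (negPart_mem hz)
      (add_nonneg (n _) (p _)) (n _), τ.add _ (negPart_mem hd) _ (posPart_mem hy) (n _) (p _)] at e2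
  have e3 := congrArg ENNReal.toReal e2
  rw [ENNReal.toReal_add (ENNReal.add_lt_top.2 ⟨hf.1, hyf.2⟩).ne hzf.1.ne,
    ENNReal.toReal_add hf.1.ne hyf.2.ne,
    ENNReal.toReal_add (ENNReal.add_lt_top.2 ⟨hf.2, hyf.1⟩).ne hzf.2.ne,
    ENNReal.toReal_add hf.2.ne hyf.1.ne] at e3
  simp only [trSA]
  linarith

theorem tr_sub {x y : H →L[ℂ] H} (hx : x ∈ N) (hy : y ∈ N)
    (hxr : τ.FiniteParts (ℜ x : H →L[ℂ] H)) (hxi : τ.FiniteParts (ℑ x : H →L[ℂ] H))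
    (hyr : τ.FiniteParts (ℜ y : H →L[ℂ] H)) (hyi : τ.FiniteParts (ℑ y : H →L[ℂ] H)) :
    τ.tr (x - y) = τ.tr x - τ.tr y := by
  simp only [tr_eq, map_sub, AddSubgroupClass.coe_sub]
  rw [trSA_sub (realPart_mem hx) (realPart_mem hy) (ℜ x).2 (ℜ y).2 hxr hyr,
    trSA_sub (imaginaryPart_mem hx) (imaginaryPart_mem hy) (ℑ x).2 (ℑ y).2 hxi hyi]
  push_cast
  ring

variable (τ)

/-- From (p - q)*(p - q) ≥ 0 one gets Re(pq) ≤ (p² + q*q)/2, and `toFun_posPart_le` passes to the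
positive part. The factor 1/2 is given away. Replacing q by -q or -iq later yields the negative part
and the imaginary part. -/
theorem toFun_realPart_mul_posPart_le {p q : H →L[ℂ] H} (hp : p ∈ N) (hq : q ∈ N)
    (hps : star p = p) :
    τ.toFun (ℜ (p * q) : H →L[ℂ] H)⁺ ≤ τ.toFun (p * p) + τ.toFun (star q * q) := by
  have hpp : 0 ≤ p * p := by
    have := star_mul_self_nonneg p
    rwa [hps] at this
  have hqq := star_mul_self_nonneg q
  have hqN : star q * q ∈ N := mul_mem (star_mem hq) hq
  rw [← τ.add _ (mul_mem hp hp) _ hqN hpp hqq]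
  refine τ.toFun_posPart_le (realPart_mem (mul_mem hp hq)) (add_mem (mul_mem hp hp) hqN)
    (ℜ (p * q)).2 (add_nonneg hpp hqq) ?_
  have h := star_mul_self_nonneg (p - q)
  have e : star (p - q) * (p - q) = p * p + star q * q - (p * q + star (p * q)) := by
    rw [star_sub, star_mul, hps, sub_mul, mul_sub, mul_sub]
    abel
  rw [e, sub_nonneg] at h
  have h' := smul_le_smul_of_nonneg_left h (show (0 : ℝ) ≤ 2⁻¹ by norm_num)
  rw [realPart_apply_coe]
  refine h'.trans ?_
  have h3 := smul_nonneg (show (0 : ℝ) ≤ 2⁻¹ by norm_num) (add_nonneg hpp hqq)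
  have h4 : (2⁻¹ : ℝ) • (p * p + star q * q) + (2⁻¹ : ℝ) • (p * p + star q * q) =
      p * p + star q * q := by
    rw [← add_smul]; norm_num
  calc _ ≤ _ := le_add_of_nonneg_right h3
    _ = _ := h4

theorem toFun_realPart_mul_negPart_le {p q : H →L[ℂ] H} (hp : p ∈ N) (hq : q ∈ N)
    (hps : star p = p) :
    τ.toFun (ℜ (p * q) : H →L[ℂ] H)⁻ ≤ τ.toFun (p * p) + τ.toFun (star q * q) := by
  have h := τ.toFun_realPart_mul_posPart_le hp (neg_mem hq) hps
  rwa [mul_neg, map_neg, NegMemClass.coe_neg, CFC.posPart_neg, star_neg, neg_mul_neg] at h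

theorem imaginaryPart_mul_eq (p q : H →L[ℂ] H) :
    (ℑ (p * q)) = ℜ (p * ((-Complex.I) • q)) := by
  rw [mul_smul_comm, neg_smul, map_neg, realPart_I_smul, neg_neg]

theorem star_negI_smul_mul (q : H →L[ℂ] H) :
    star ((-Complex.I) • q) * ((-Complex.I) • q) = star q * q := by
  rw [star_smul, smul_mul_smul_comm]
  simp

theorem norm_tr_mul_le {p q : H →L[ℂ] H} (hp : p ∈ N) (hq : q ∈ N) (hps : star p = p) {c : ℝ≥0∞}
    (hc : τ.toFun (p * p) + τ.toFun (star q * q) ≤ c) (hct : c < ∞) :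
    τ.FiniteParts (ℜ (p * q) : H →L[ℂ] H) ∧ τ.FiniteParts (ℑ (p * q) : H →L[ℂ] H) ∧
      ‖τ.tr (p * q)‖ ≤ 2 * c.toReal := by
  have aux : ∀ {q : H →L[ℂ] H}, q ∈ N → τ.toFun (p * p) + τ.toFun (star q * q) ≤ c →
      τ.FiniteParts (ℜ (p * q) : H →L[ℂ] H) ∧ |τ.trSA (ℜ (p * q) : H →L[ℂ] H)| ≤ c.toReal := by
    intro q hq hc
    have h1 := (τ.toFun_realPart_mul_posPart_le hp hq hps).trans hc
    have h2 := (τ.toFun_realPart_mul_negPart_le hp hq hps).trans hc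
    refine ⟨⟨h1.trans_lt hct, h2.trans_lt hct⟩, ?_⟩
    have h3 := ENNReal.toReal_mono hct.ne h1
    have h4 := ENNReal.toReal_mono hct.ne h2
    rw [trSA]
    exact abs_sub_le_of_nonneg_of_le ENNReal.toReal_nonneg h3 ENNReal.toReal_nonneg h4
  have h1 := aux hq hc
  have h2 := aux (smul_mem (-Complex.I) hq) (by rwa [star_negI_smul_mul])
  rw [← imaginaryPart_mul_eq] at h2
  refine ⟨h1.1, h2.1, ?_⟩
  rw [tr_eq]
  refine (norm_add_le _ _).trans ?_
  rw [norm_mul, Complex.norm_I, one_mul, Complex.norm_real, Complex.norm_real, Real.norm_eq_abs,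
    Real.norm_eq_abs]
  linarith [h1.2, h2.2]

/-- Trace-class estimate for `g(A) B` when `|g| ≤ φ` on the spectrum of `A`. -/
theorem opFun_mul_estimate {A B : H →L[ℂ] H} (hA : A ∈ N) (hA0 : 0 ≤ A) (hB : B ∈ N)
    {g : ℝ → ℂ} {φ : ℝ → ℝ} (hg : ContinuousOn g (spectrum ℝ A))
    (hφ : ContinuousOn φ (spectrum ℝ A)) (hle : ∀ x ∈ spectrum ℝ A, ‖g x‖ ≤ φ x)
    (hfin : τ.toFun (cfc φ A) < ∞) :
    opFun g A * B ∈ τ.L1 ∧ τ.FiniteParts (ℜ (opFun g A * B) : H →L[ℂ] H) ∧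
      τ.FiniteParts (ℑ (opFun g A * B) : H →L[ℂ] H) ∧
      ‖τ.tr (opFun g A * B)‖ ≤ 2 * (1 + ‖B‖ ^ 2) * (τ.toFun (cfc φ A)).toReal := by
  have hsa : IsSelfAdjoint A := hA0.isSelfAdjoint
  -- Hilbert–Schmidt factorisation: g = r b with |b| = r = |g|^{1/2}, p = r(A) and q = b(A)B. Then
  -- p² ≤ φ(A) and q*q = B*p²B.
  set r : ℝ → ℝ := fun x ↦ √‖g x‖ with hr
  have hrc : ContinuousOn r (spectrum ℝ A) := hg.norm.sqrt
  have hrr : ∀ x, r x * r x = ‖g x‖ := fun x ↦ Real.mul_self_sqrt (norm_nonneg _)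
  set b : ℝ → ℂ := fun x ↦ g x / (r x : ℂ) with hb
  have hbn : ∀ x, ‖b x‖ = r x := by
    intro x
    simp only [hb, norm_div, Complex.norm_real, Real.norm_of_nonneg (Real.sqrt_nonneg _), hr]
    rw [Real.div_sqrt]
  have hrb : ∀ x, (r x : ℂ) * b x = g x := by
    intro x
    by_cases h : r x = 0
    · have : ‖g x‖ = 0 := by rw [← hrr, h, zero_mul]
      rw [h, norm_eq_zero.1 this]; simp
    · simp only [hb]
      rw [mul_div_cancel₀]
      exact_mod_cast h
  have hbc : ContinuousOn b (spectrum ℝ A) := by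
    intro x hx
    by_cases h : r x = 0
    · have hb0 : b x = 0 := by rw [← norm_eq_zero, hbn, h]
      rw [ContinuousWithinAt, hb0]
      refine squeeze_zero_norm (fun y ↦ (hbn y).le) ?_
      have := hrc x hx
      rwa [ContinuousWithinAt, h] at this
    · exact (hg x hx).div (Complex.continuous_ofReal.continuousAt.comp_continuousWithinAt (hrc x hx))
        (by exact_mod_cast h)
  set p := cfc r A with hp
  set q := opFun b A * B with hq
  have hpN : p ∈ N := cfc_real_mem hA r
  have hqN : q ∈ N := mul_mem (opFun_mem hA b) hB
  have hps : star p = p := IsSelfAdjoint.cfc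
  have hpq : opFun g A * B = p * q := by
    rw [hq, ← mul_assoc, hp, ← opFun_ofReal hsa r,
      ← opFun_mul hsa (f := fun x ↦ (r x : ℂ)) (Complex.continuous_ofReal.comp_continuousOn hrc) hbc]
    simp only [hrb]
  set Z := cfc φ A with hZ
  have hZN : Z ∈ N := cfc_real_mem hA φ
  have hpp : p * p ≤ Z := by
    rw [hp, ← cfc_mul r r A hrc hrc]
    exact cfc_mono (fun x hx ↦ by rw [hrr]; exact hle x hx) (hrc.mul hrc) hφ
  have hZ0 : 0 ≤ Z := cfc_nonneg fun x hx ↦ (norm_nonneg _).trans (hle x hx)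
  have hpp0 : 0 ≤ p * p := by
    have := star_mul_self_nonneg p
    rwa [hps] at this
  have hqq : star q * q ≤ star B * Z * B := by
    have : star q * q = star B * (p * p) * B := by
      have e : star (opFun b A) * opFun b A = p * p := by
        rw [star_opFun, ← opFun_mul hsa (f := fun x ↦ star (b x)) (continuous_star.comp_continuousOn hbc) hbc, hp,
          ← cfc_mul r r A hrc hrc, ← opFun_ofReal hsa]
        congr 1
        ext x
        rw [← hbn x, ← sq, Complex.ofReal_pow]
        exact Complex.conj_mul' (b x)
      rw [hq, star_mul, ← e]; simp only [mul_assoc]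
    rw [this]
    exact star_left_conjugate_le_conjugate hpp B
  set c := ENNReal.ofReal (1 + ‖B‖ ^ 2) * τ.toFun Z with hc
  have hct : c < ∞ := ENNReal.mul_lt_top ENNReal.ofReal_lt_top hfin
  have hle' : τ.toFun (p * p) + τ.toFun (star q * q) ≤ c := by
    rw [hc, ENNReal.ofReal_add zero_le_one (by positivity), ENNReal.ofReal_one, add_mul, one_mul]
    refine add_le_add (τ.toFun_mono (mul_mem hpN hpN) hZN hpp0 hpp) ?_
    exact (τ.toFun_mono (mul_mem (star_mem hqN) hqN) (mul_mem (mul_mem (star_mem hB) hZN) hB)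
      (star_mul_self_nonneg q) hqq).trans (τ.toFun_conj_le hZN hB hZ0)
  obtain ⟨h1, h2, h3⟩ := τ.norm_tr_mul_le hpN hqN hps hle' hct
  rw [← hpq] at h1 h2 h3
  refine ⟨⟨mul_mem (opFun_mem hA g) hB, ?_⟩, h1, h2, h3.trans (le_of_eq ?_)⟩
  · have h := (τ.toFun_abs_mul_le hpN hqN hps).trans hle'
    rw [hpq]
    refine lt_of_le_of_lt ?_ hct
    refine le_trans ?_ h
    rw [two_mul]
    exact le_self_add
  · rw [hc, ENNReal.toReal_mul, ENNReal.toReal_ofReal (by positivity)]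
    ring

end FNSTrace

/-! ### Dyadic cutoffs and real-variable inequalities -/

/-- A continuous cutoff vanishing on `(-∞, 2⁻ᵏ]` and equal to `1` on `[2¹⁻ᵏ, ∞)`. -/
noncomputable def dyadicCutoff (k : ℕ) (x : ℝ) : ℝ := min 1 (max 0 (2 ^ k * x - 1))

theorem continuous_dyadicCutoff (k : ℕ) : Continuous (dyadicCutoff k) := by
  unfold dyadicCutoff; fun_prop

theorem dyadicCutoff_nonneg (k : ℕ) (x : ℝ) : 0 ≤ dyadicCutoff k x :=
  le_min zero_le_one (le_max_left _ _)

theorem dyadicCutoff_le_one (k : ℕ) (x : ℝ) : dyadicCutoff k x ≤ 1 := min_le_left _ _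

theorem dyadicCutoff_eq_zero {k : ℕ} {x : ℝ} (h : x ≤ (1 / 2) ^ k) : dyadicCutoff k x = 0 := by
  have h1 : (2 : ℝ) ^ k * x ≤ 1 := by
    calc (2 : ℝ) ^ k * x ≤ 2 ^ k * (1 / 2) ^ k := by gcongr
      _ = 1 := by rw [← mul_pow]; norm_num
  rw [dyadicCutoff, max_eq_left (by linarith), min_eq_right zero_le_one]

theorem dyadicCutoff_eq_one {k : ℕ} {x : ℝ} (h : 2 / 2 ^ k ≤ x) : dyadicCutoff k x = 1 := by
  rw [div_le_iff₀ (by positivity)] at h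
  rw [dyadicCutoff, min_eq_left]
  exact le_max_of_le_right (by linarith)

theorem dyadicCutoff_mono_left {j k : ℕ} (hjk : j ≤ k) {x : ℝ} (hx : 0 ≤ x) :
    dyadicCutoff j x ≤ dyadicCutoff k x := by
  unfold dyadicCutoff
  have : (2 : ℝ) ^ j ≤ 2 ^ k := pow_le_pow_right₀ one_le_two hjk
  gcongr

/-- A dyadic layer-cake bound for `min(1, s²x²)`. -/
theorem le_or_min_le_sum_dyadicCutoff {s x : ℝ} (hs : 1 ≤ s) (hx : 0 ≤ x) (K : ℕ) :
    x ≤ 4 / 2 ^ (K + 1) ∨ min 1 ((s * x) ^ 2) ≤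
      ∑ k ∈ Finset.range (K + 1), 16 * min 1 (s ^ 2 / 4 ^ k) * dyadicCutoff k x ^ 2 := by
  induction K with
  | zero =>
    rcases le_or_gt x 2 with h | h
    · left; norm_num; exact h
    · right
      rw [Finset.sum_range_one, dyadicCutoff_eq_one (by norm_num; exact h.le)]
      rw [pow_zero, div_one, min_eq_left (by nlinarith : (1 : ℝ) ≤ s ^ 2)]
      exact (min_le_left _ _).trans (by norm_num)
  | succ K ih =>
    rw [Finset.sum_range_succ]
    rcases ih with h | h
    · rcases le_or_gt x (2 / 2 ^ (K + 1)) with h' | h'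
      · left
        refine h'.trans (le_of_eq ?_)
        rw [pow_succ 2 (K + 1)]
        field_simp
        norm_num
      · right
        -- Here 2/2^(K+1) < x ≤ 4/2^(K+1), so the new layer alone suffices; the factor 16 is 4².
        rw [dyadicCutoff_eq_one h'.le]
        have h0 : (0 : ℝ) ≤ ∑ k ∈ Finset.range (K + 1),
            16 * min 1 (s ^ 2 / 4 ^ k) * dyadicCutoff k x ^ 2 :=
          Finset.sum_nonneg fun k _ ↦ by positivity
        have h1 : (s * x) ^ 2 ≤ 16 * (s ^ 2 / 4 ^ (K + 1)) := by
          have e : (16 : ℝ) * (s ^ 2 / 4 ^ (K + 1)) = (s * (4 / 2 ^ (K + 1))) ^ 2 := by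
            have : (4 : ℝ) ^ (K + 1) = (2 ^ (K + 1)) ^ 2 := by
              rw [← pow_mul, mul_comm, pow_mul]; norm_num
            rw [this]; field_simp; norm_num
          rw [e]
          gcongr
        have h2 : min 1 ((s * x) ^ 2) ≤ 16 * min 1 (s ^ 2 / 4 ^ (K + 1)) := by
          rw [mul_min_of_nonneg _ _ (by norm_num : (0 : ℝ) ≤ 16)]
          exact min_le_min (by norm_num) h1
        linarith
    · right
      refine h.trans (le_add_of_nonneg_right ?_)
      positivity

/-- Summation by parts against a nonincreasing function bounded below on `[0, n_k)` by `2⁻ᵏ⁻¹`. -/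
theorem sum_dyadic_le_integral {μ : ℝ → ℝ} (hμ : Antitone μ) {n : ℕ → ℝ} (hn : Monotone n)
    (hn0 : ∀ k, 0 ≤ n k) (h : ∀ k u, 0 ≤ u → u < n k → (1 / 2) ^ (k + 1) ≤ μ u) (K : ℕ) :
    ∑ k ∈ Finset.range (K + 1), (1 / 2 : ℝ) ^ (k + 1) * n k + (1 / 2) ^ (K + 1) * n K ≤
      2 * ∫ u in (0 : ℝ)..n K, μ u := by
  have hint : ∀ a b : ℝ, IntervalIntegrable μ volume a b := fun a b ↦ hμ.intervalIntegrable
  have hlow : ∀ k a, 0 ≤ a → a ≤ n k → (1 / 2 : ℝ) ^ (k + 1) * (n k - a) ≤ ∫ u in a..n k, μ u := by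
    intro k a ha hak
    have := intervalIntegral.integral_mono_on_of_le_Ioo hak
      (intervalIntegrable_const (c := (1 / 2 : ℝ) ^ (k + 1))) (hint a (n k))
      (fun u hu ↦ h k u (ha.trans hu.1.le) hu.2)
    rw [intervalIntegral.integral_const, smul_eq_mul] at this
    linarith
  -- The boundary term (1/2)^(K+1) n_K is what makes the induction close: it cancels the loss -n_K
  -- when the integral over [n_K, n_{K+1}] is bounded below.
  induction K with
  | zero =>
    have := hlow 0 0 le_rfl (hn0 0)
    simp only [zero_add, Finset.sum_range_one] at this ⊢
    linarith
  | succ K ih =>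
    rw [Finset.sum_range_succ, ← intervalIntegral.integral_add_adjacent_intervals
      (hint 0 (n K)) (hint (n K) (n (K + 1)))]
    have := hlow (K + 1) (n K) (hn0 K) (hn K.le_succ)
    have e : (1 / 2 : ℝ) ^ (K + 1) = 2 * (1 / 2) ^ (K + 1 + 1) := by
      rw [pow_succ _ (K + 1)]; ring
    rw [e] at ih
    linarith

theorem log_one_add_le_two_sqrt {v : ℝ} (hv : 0 ≤ v) : Real.log (1 + v) ≤ 2 * √v := by
  have h1 : 1 + v ≤ (1 + √v) ^ 2 := by
    nlinarith [Real.sq_sqrt hv, Real.sqrt_nonneg v]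
  have h2 : (0 : ℝ) < 1 + √v := by positivity
  calc Real.log (1 + v) ≤ Real.log ((1 + √v) ^ 2) := Real.log_le_log (by linarith) h1
    _ = 2 * Real.log (1 + √v) := by rw [Real.log_pow]; norm_num
    _ ≤ 2 * √v := by
      have := Real.log_le_sub_one_of_pos h2
      linarith

/-- Bootstrapping through log(1 + v) ≤ 2√v. Any power of `a` would do, since the bound is later used
under a logarithm with a = 2^(k+1). -/
theorem le_of_mul_le_log {v a C : ℝ} (hv : 0 ≤ v) (ha : 0 < a) (hC : 0 ≤ C)
    (h : v ≤ a * (C * Real.log (1 + v))) : v ≤ 4 * a ^ 2 * C ^ 2 := by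
  have h1 : v ≤ 2 * a * C * √v := by
    refine h.trans ?_
    calc a * (C * Real.log (1 + v)) ≤ a * (C * (2 * √v)) := by
          gcongr; exact log_one_add_le_two_sqrt hv
      _ = _ := by ring
  by_contra! hcon
  have hs := Real.sqrt_nonneg v
  have hss := Real.sq_sqrt hv
  have hpos : 0 < √v := by
    rcases hs.eq_or_lt with h0 | h0
    · rw [← h0] at hss
      nlinarith [sq_nonneg (a * C)]
    · exact h0
  have h2 : √v ≤ 2 * a * C := by
    by_contra! h3
    nlinarith
  have : √v ^ 2 ≤ (2 * a * C) ^ 2 := by gcongr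
  nlinarith


/-! ### From the Marcinkiewicz condition to dyadic traces -/

namespace FNSTrace

variable {H : Type*} [NormedAddCommGroup H] [InnerProductSpace ℂ H] [CompleteSpace H]
  {N : VonNeumannAlgebra H} (τ : FNSTrace N)

/-- The trace of the `k`-th dyadic cutoff of `A`. -/
noncomputable def dyadicTrace (A : H →L[ℂ] H) (k : ℕ) : ℝ≥0∞ :=
  τ.toFun (cfc (fun x ↦ dyadicCutoff k x ^ 2) A)

theorem singularValue_set_nonempty (t : ℝ) (A : H →L[ℂ] H) :
    {r : ℝ | ∃ p ∈ N, IsStarProjection p ∧ τ.toFun (1 - p) ≤ ENNReal.ofReal t ∧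
      r = ‖A * p‖}.Nonempty :=
  ⟨_, 1, one_mem N, .one _, by simp [τ.toFun_zero], rfl⟩

theorem antitone_singularValue (A : H →L[ℂ] H) : Antitone fun t ↦ τ.singularValue t A := by
  intro s t hst
  refine csInf_le_csInf ⟨0, ?_⟩ (τ.singularValue_set_nonempty s A) ?_
  · rintro _ ⟨p, -, -, -, rfl⟩
    exact norm_nonneg _
  · rintro _ ⟨p, hp, hpp, hle, rfl⟩
    exact ⟨p, hp, hpp, hle.trans (ENNReal.ofReal_le_ofReal hst), rfl⟩

/-- With R = ρ(A) = Aγ(A), G = γ(A) and r = 2⁻ᵏ, one has RpR = G(ApA)G ≤ ‖Ap‖² G² ≤ (r/2)² G² ≤ ¼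
R², because rγ ≤ ρ. Hence ¾ R² ≤ R(1 - p)R, and compression by the contraction R does not increase
the trace. -/
theorem dyadicTrace_le_of_norm_mul_lt {A p : H →L[ℂ] H} (hA : A ∈ N) (hA0 : 0 ≤ A) (hp : p ∈ N)
    (hpp : IsStarProjection p) {k : ℕ} (h : ‖A * p‖ < (1 / 2) ^ (k + 1)) :
    ENNReal.ofReal (3 / 4) * τ.dyadicTrace A k ≤ τ.toFun (1 - p) := by
  have hsa : IsSelfAdjoint A := hA0.isSelfAdjoint
  set ρ := dyadicCutoff k with hρ
  have hρc : Continuous ρ := continuous_dyadicCutoff k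
  set r : ℝ := (1 / 2) ^ k with hr
  have hr0 : 0 < r := by positivity
  -- The maximum keeps the denominator positive and leaves xγ(x) = ρ(x) intact, as ρ vanishes for x
  -- ≤ r.
  set γ : ℝ → ℝ := fun x ↦ ρ x / max x r with hγ
  have hmpos : ∀ x, 0 < max x r := fun x ↦ lt_max_of_lt_right hr0
  have hγc : Continuous γ := hρc.div (by fun_prop) fun x ↦ (hmpos x).ne'
  have hγx : ∀ x, x * γ x = ρ x := by
    intro x
    rcases le_total x r with hx | hx
    · simp only [hγ]
      rw [hρ, dyadicCutoff_eq_zero hx]; simp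
    · simp only [hγ, max_eq_left hx]
      have : x ≠ 0 := (hr0.trans_le hx).ne'
      field_simp
  have hγle : ∀ x, r * γ x ≤ ρ x := by
    intro x
    simp only [hγ]
    rw [mul_div_assoc', div_le_iff₀ (hmpos x), mul_comm]
    exact mul_le_mul_of_nonneg_left (le_max_right _ _) (dyadicCutoff_nonneg k x)
  have hγ0 : ∀ x, 0 ≤ γ x := fun x ↦ div_nonneg (dyadicCutoff_nonneg k x) (hmpos x).le
  set R := cfc ρ A with hR
  set G := cfc γ A with hG
  have hRN : R ∈ N := cfc_real_mem hA ρ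
  have hRs : star R = R := IsSelfAdjoint.cfc
  have hGs : star G = G := IsSelfAdjoint.cfc
  have hAG : A * G = R := by
    rw [hR, ← cfc_congr (f := fun x ↦ x * γ x) (fun x _ ↦ hγx x),
      cfc_mul (fun x ↦ x) γ A continuousOn_id hγc.continuousOn, cfc_id' ℝ A]
  have hGA : G * A = R := by
    have := congrArg star hAG
    rwa [star_mul, hGs, hRs, hsa.star_eq] at this
  have hRR : cfc (fun x ↦ ρ x ^ 2) A = R * R := by
    rw [hR, ← cfc_mul ρ ρ A hρc.continuousOn hρc.continuousOn]
    simp only [sq]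
  have hRp : R * p * R ≤ (1 / 4 : ℝ) • (R * R) := by
    have e : R * p * R = star G * (A * p * star (A * p)) * G := by
      rw [hGs, star_mul, hpp.isSelfAdjoint.star_eq, hsa.star_eq]
      have : A * p * (p * A) = A * p * A := by
        rw [mul_assoc, ← mul_assoc p p A, hpp.isIdempotentElem.eq, ← mul_assoc]
      rw [this]
      calc R * p * R = G * A * p * (A * G) := by rw [hGA, hAG]
        _ = _ := by simp only [mul_assoc]
    rw [e]
    refine (star_left_conjugate_le_conjugate CStarAlgebra.mul_star_le_algebraMap_norm_sq G).trans ?_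
    rw [hGs, Algebra.algebraMap_eq_smul_one, mul_smul_comm, mul_one, smul_mul_assoc, hG, hR,
      ← cfc_mul γ γ A hγc.continuousOn hγc.continuousOn,
      ← cfc_mul ρ ρ A hρc.continuousOn hρc.continuousOn,
      ← cfc_smul _ (fun x ↦ γ x * γ x) A (hγc.mul hγc).continuousOn,
      ← cfc_smul _ (fun x ↦ ρ x * ρ x) A (hρc.mul hρc).continuousOn]
    refine cfc_mono (fun x _ ↦ ?_) (by fun_prop) (by fun_prop)
    simp only [smul_eq_mul]
    have h1 : ‖A * p‖ ^ 2 ≤ (r / 2) ^ 2 := by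
      have : ‖A * p‖ ≤ r / 2 := by
        rw [pow_succ] at h
        linarith
      gcongr
    calc ‖A * p‖ ^ 2 * (γ x * γ x) ≤ (r / 2) ^ 2 * (γ x * γ x) := by
          have := mul_self_nonneg (γ x)
          gcongr
      _ = 1 / 4 * ((r * γ x) * (r * γ x)) := by ring
      _ ≤ 1 / 4 * (ρ x * ρ x) := by
          have h2 := hγle x
          have h3 : 0 ≤ r * γ x := mul_nonneg hr0.le (hγ0 x)
          have h4 : 0 ≤ ρ x := dyadicCutoff_nonneg k x
          gcongr
  have hRn : ‖R‖ ≤ 1 := norm_cfc_le zero_le_one fun x _ ↦ by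
    rw [Real.norm_of_nonneg (dyadicCutoff_nonneg k x)]
    exact dyadicCutoff_le_one k x
  have hRR0 : 0 ≤ R * R := by
    have := star_mul_self_nonneg R
    rwa [hRs] at this
  have hpN : 1 - p ∈ N := sub_mem (one_mem N) hp
  have hp0 : 0 ≤ 1 - p := hpp.one_sub.nonneg
  rw [dyadicTrace, hRR, ← τ.toFun_real_smul (by norm_num) (mul_mem hRN hRN) hRR0]
  refine le_trans ?_ (τ.toFun_conj_le_of_norm_le_one hpN hRN hp0 hRn)
  refine τ.toFun_mono (real_smul_mem _ (mul_mem hRN hRN))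
    (mul_mem (mul_mem (star_mem hRN) hpN) hRN) (smul_nonneg (by norm_num) hRR0) ?_
  rw [hRs, mul_sub, sub_mul, mul_one, le_sub_comm]
  refine hRp.trans (le_of_eq ?_)
  rw [eq_sub_iff_add_eq, ← add_smul]
  norm_num

theorem le_singularValue {A : H →L[ℂ] H} (hA : A ∈ N) (hA0 : 0 ≤ A) {k : ℕ} {u : ℝ}
    (h : ENNReal.ofReal u < ENNReal.ofReal (3 / 4) * τ.dyadicTrace A k) :
    (1 / 2) ^ (k + 1) ≤ τ.singularValue u A := by
  by_contra! hcon
  obtain ⟨_, ⟨p, hp, hpp, hle, rfl⟩, hlt⟩ :=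
    exists_lt_of_csInf_lt (τ.singularValue_set_nonempty u A) hcon
  exact absurd ((τ.dyadicTrace_le_of_norm_mul_lt hA hA0 hp hpp hlt).trans hle) (not_le.2 h)

theorem monotone_dyadicTrace {A : H →L[ℂ] H} (hA : A ∈ N) (hA0 : 0 ≤ A) :
    Monotone (τ.dyadicTrace A) := by
  intro j k hjk
  refine τ.toFun_mono (cfc_real_mem hA _) (cfc_real_mem hA _) (cfc_nonneg fun x _ ↦ sq_nonneg _) ?_
  have hj := continuous_dyadicCutoff j
  have hk := continuous_dyadicCutoff k
  refine cfc_mono (fun x hx ↦ ?_)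
  have := dyadicCutoff_mono_left hjk (spectrum_nonneg_of_nonneg hA0 hx)
  have h0 := dyadicCutoff_nonneg j x
  gcongr

/-- Growth of the distribution of a positive element of `𝓜_{1,∞}`. -/
theorem exists_dyadicTrace_bound {A : H →L[ℂ] H} (hA : A ∈ τ.M1Infty) (hA0 : 0 ≤ A) :
    ∃ D : ℝ, 0 ≤ D ∧ (∀ k, τ.dyadicTrace A k < ∞) ∧
      (∀ k : ℕ, (τ.dyadicTrace A k).toReal ≤ D * (k + 1) * 2 ^ k) ∧
      ∀ K : ℕ, ∑ k ∈ Finset.range (K + 1), (τ.dyadicTrace A k).toReal / 2 ^ k ≤ D * (K + 1) := by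
  obtain ⟨hAN, C', hC'⟩ := hA
  set μ : ℝ → ℝ := fun s ↦ τ.singularValue s A with hμ
  have hanti : Antitone μ := τ.antitone_singularValue A
  have hint : ∀ a b : ℝ, IntervalIntegrable μ volume a b := fun a b ↦ hanti.intervalIntegrable
  set C := max C' 0 with hCdef
  have hC0 : 0 ≤ C := le_max_right _ _
  have hI : ∀ t : ℝ, 0 ≤ t → ∫ s in (0 : ℝ)..t, μ s ≤ C * Real.log (1 + t) := by
    intro t ht
    rcases ht.eq_or_lt with rfl | ht
    · simp
    · have h1 : 0 < Real.log (1 + t) := Real.log_pos (by linarith)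
      have h2 := (hC' ⟨t, ht, rfl⟩).trans (le_max_left C' 0)
      simp only [one_div_mul_eq_div] at h2
      rw [div_le_iff₀ h1] at h2
      exact h2
  set m : ℕ → ℝ≥0∞ := fun k ↦ ENNReal.ofReal (3 / 4) * τ.dyadicTrace A k with hm
  -- Stated for every real v below m k, so that it also rules out m k = ∞.
  have hbd : ∀ (k : ℕ) (v : ℝ), 0 ≤ v → ENNReal.ofReal v ≤ m k → v ≤ 4 * (2 ^ (k + 1)) ^ 2 * C ^ 2 := by
    intro k v hv hvm
    refine le_of_mul_le_log hv (by positivity) hC0 ?_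
    have h1 := intervalIntegral.integral_mono_on_of_le_Ioo hv
      (intervalIntegrable_const (c := (1 / 2 : ℝ) ^ (k + 1))) (hint 0 v) (fun u hu ↦
        τ.le_singularValue hAN hA0 (lt_of_lt_of_le
          ((ENNReal.ofReal_lt_ofReal_iff (hu.1.trans hu.2)).2 hu.2) hvm))
    rw [intervalIntegral.integral_const, smul_eq_mul, sub_zero] at h1
    have h2 := h1.trans (hI v hv)
    calc v = 2 ^ (k + 1) * (v * (1 / 2) ^ (k + 1)) := by
          rw [mul_left_comm, ← mul_pow]; norm_num
      _ ≤ _ := by gcongr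
  have hmfin : ∀ k, m k < ∞ := by
    intro k
    by_contra! h
    have := hbd k (4 * (2 ^ (k + 1)) ^ 2 * C ^ 2 + 1) (by positivity) (le_top.trans h)
    linarith
  have hNfin : ∀ k, τ.dyadicTrace A k < ∞ := by
    intro k
    have h := hmfin k
    by_contra! h'
    rw [top_le_iff] at h'
    simp only [hm, h'] at h
    rw [ENNReal.mul_top (by simp)] at h
    exact lt_irrefl _ h
  set n : ℕ → ℝ := fun k ↦ (m k).toReal with hn
  have hn0 : ∀ k, 0 ≤ n k := fun k ↦ ENNReal.toReal_nonneg
  have hnm : ∀ k, ENNReal.ofReal (n k) = m k := fun k ↦ ENNReal.ofReal_toReal (hmfin k).ne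
  have hnN : ∀ k, (τ.dyadicTrace A k).toReal = 4 / 3 * n k := by
    intro k
    simp only [hn, hm, ENNReal.toReal_mul]
    rw [ENNReal.toReal_ofReal (by norm_num)]
    ring
  have hnmono : Monotone n := fun j k hjk ↦ ENNReal.toReal_mono (hmfin k).ne
    (mul_le_mul_right (τ.monotone_dyadicTrace hAN hA0 hjk) _)
  have hlow : ∀ k u, 0 ≤ u → u < n k → (1 / 2) ^ (k + 1) ≤ μ u := by
    intro k u hu hun
    refine τ.le_singularValue hAN hA0 ?_
    have := (ENNReal.ofReal_lt_ofReal_iff (hu.trans_lt hun)).2 hun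
    rwa [hnm] at this
  have hsum := sum_dyadic_le_integral hanti hnmono hn0 hlow
  -- The bound n_k ≤ 16 C² 4ᵏ gives log(1 + n_k) ≤ log(1 + 16C²) + k log 4.
  set C₁ := Real.log (1 + 16 * C ^ 2) + Real.log 4 with hC₁
  have hl4 : 0 ≤ Real.log 4 := Real.log_nonneg (by norm_num)
  have hlC : 0 ≤ Real.log (1 + 16 * C ^ 2) := Real.log_nonneg (by nlinarith [sq_nonneg C])
  have hC₁0 : 0 ≤ C₁ := add_nonneg hlC hl4
  have hlog : ∀ k : ℕ, Real.log (1 + n k) ≤ C₁ * (k + 1) := by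
    intro k
    have h1 := hbd k (n k) (hn0 k) (hnm k).le
    have h4 : ((2 : ℝ) ^ (k + 1)) ^ 2 = 4 * 4 ^ k := by
      rw [← pow_mul, mul_comm, pow_mul, pow_succ]; norm_num; ring
    rw [h4] at h1
    have h5 : (1 : ℝ) ≤ 4 ^ k := one_le_pow₀ (by norm_num)
    have h2 : 1 + n k ≤ (1 + 16 * C ^ 2) * 4 ^ k := by nlinarith
    have h3 := Real.log_le_log (by linarith [hn0 k]) h2
    rw [Real.log_mul (by positivity) (by positivity), Real.log_pow] at h3
    have h6 : (0 : ℝ) ≤ k := k.cast_nonneg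
    rw [hC₁]
    nlinarith [mul_nonneg h6 hlC]
  have hmain : ∀ K : ℕ, ∑ k ∈ Finset.range (K + 1), (1 / 2 : ℝ) ^ (k + 1) * n k ≤
      2 * C * C₁ * (K + 1) := by
    intro K
    have h1 := hsum K
    have h2 := hI (n K) (hn0 K)
    have h3 := mul_le_mul_of_nonneg_left (hlog K) hC0
    have h4 : 0 ≤ (1 / 2 : ℝ) ^ (K + 1) * n K := mul_nonneg (by positivity) (hn0 K)
    linarith
  -- The constant 6 rounds up (8/3)·2, where 8/3 undoes the factor 3/4 and one factor 1/2.
  have hmain' : ∀ K : ℕ, ∑ k ∈ Finset.range (K + 1), (τ.dyadicTrace A k).toReal / 2 ^ k ≤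
      6 * C * C₁ * (K + 1) := by
    intro K
    have e : ∑ k ∈ Finset.range (K + 1), (τ.dyadicTrace A k).toReal / 2 ^ k =
        8 / 3 * ∑ k ∈ Finset.range (K + 1), (1 / 2 : ℝ) ^ (k + 1) * n k := by
      rw [Finset.mul_sum]
      refine Finset.sum_congr rfl fun k _ ↦ ?_
      rw [hnN, pow_succ, one_div_pow]
      ring
    rw [e]
    have h0 : 0 ≤ C * C₁ * (K + 1) := by positivity
    linarith [hmain K]
  refine ⟨6 * C * C₁, by positivity, hNfin, fun k ↦ ?_, hmain'⟩
  have h1 := Finset.single_le_sum (f := fun k ↦ (τ.dyadicTrace A k).toReal / 2 ^ k)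
    (fun k _ ↦ by positivity) (Finset.mem_range.2 k.lt_succ_self)
  have h2 := h1.trans (hmain' k)
  rwa [div_le_iff₀ (by positivity)] at h2

end FNSTrace

/-! ### Bounds on f and elementary integrals -/

/-- The derivative is Lipschitz on [0, R] and vanishes at 0, so it is O(M) on [0, M]; then the mean
value inequality. With y = 0 this gives quadratic decay, and with x, y replaced by sx, s'x it gives
continuity in s. -/
theorem exists_norm_sub_le_mul_max {f : ℝ → ℂ} (hf : ContDiffOn ℝ 2 f (Ici 0))
    (hf'0 : derivWithin f (Ici 0) 0 = 0) (R : ℝ) :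
    ∃ C : ℝ, 0 ≤ C ∧ ∀ x y M : ℝ, 0 ≤ x → 0 ≤ y → x ≤ M → y ≤ M → M ≤ R →
      ‖f x - f y‖ ≤ C * M * |x - y| := by
  have h1 : ContDiffOn ℝ 1 (derivWithin f (Ici 0)) (Icc 0 R) :=
    (hf.derivWithin (uniqueDiffOn_Ici 0) (by norm_num)).mono Icc_subset_Ici_self
  obtain ⟨K, hK⟩ := h1.exists_lipschitzOnWith one_ne_zero (convex_Icc 0 R) isCompact_Icc
  refine ⟨K, K.2, fun x y M hx hy hxM hyM hMR ↦ ?_⟩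
  have hM : 0 ≤ M := hx.trans hxM
  rw [← Real.norm_eq_abs]
  refine Convex.norm_image_sub_le_of_norm_hasDerivWithin_le (s := Icc 0 M)
    (f' := derivWithin f (Ici 0)) (fun z hz ↦ ?_) (fun z hz ↦ ?_) (convex_Icc 0 M) ⟨hy, hyM⟩
    ⟨hx, hxM⟩
  · exact ((hf.differentiableOn (by norm_num)) z hz.1).hasDerivWithinAt.mono Icc_subset_Ici_self
  · have := hK.norm_sub_le (x := z) (y := 0) ⟨hz.1, hz.2.trans hMR⟩ ⟨le_rfl, hM.trans hMR⟩
    rw [hf'0, sub_zero, sub_zero, Real.norm_of_nonneg hz.1] at this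
    exact this.trans (mul_le_mul_of_nonneg_left hz.2 K.2)

theorem exists_norm_le_mul_min {f : ℝ → ℂ} (hf : ContDiffOn ℝ 2 f (Ici 0))
    (hbdd : ∃ K : ℝ, ∀ t : ℝ, 0 ≤ t → ‖f t‖ ≤ K) (hf0 : f 0 = 0)
    (hf'0 : derivWithin f (Ici 0) 0 = 0) :
    ∃ C : ℝ, 0 ≤ C ∧ ∀ x : ℝ, 0 ≤ x → ‖f x‖ ≤ C * min 1 (x ^ 2) := by
  obtain ⟨C, hC, h⟩ := exists_norm_sub_le_mul_max hf hf'0 1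
  obtain ⟨K, hK⟩ := hbdd
  refine ⟨max C K, hC.trans (le_max_left _ _), fun x hx ↦ ?_⟩
  rcases le_total x 1 with h1 | h1
  · rw [min_eq_right (pow_le_one₀ hx h1)]
    have := h x 0 x hx le_rfl le_rfl hx h1
    rw [hf0, sub_zero, sub_zero, abs_of_nonneg hx, mul_assoc, ← sq] at this
    exact this.trans (mul_le_mul_of_nonneg_right (le_max_left _ _) (sq_nonneg x))
  · rw [min_eq_left (one_le_pow₀ h1), mul_one]
    exact (hK x hx).trans (le_max_right _ _)

/-- Trades the minimum for a function with an explicit primitive, so integrating over [1, t] needs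
no splitting at s = a. -/
theorem min_one_div_le {s a : ℝ} (hs : 0 < s) (ha : 0 < a) :
    min 1 (s ^ 2 / a ^ 2) ≤ s ^ 2 * (4 / (s + a) ^ 2) := by
  rw [mul_div_assoc', le_div_iff₀ (by positivity)]
  rcases le_total s a with h | h
  · calc min 1 (s ^ 2 / a ^ 2) * (s + a) ^ 2 ≤ s ^ 2 / a ^ 2 * (a + a) ^ 2 := by
          gcongr; exact min_le_right _ _
      _ = s ^ 2 * 4 := by field_simp; norm_num
  · calc min 1 (s ^ 2 / a ^ 2) * (s + a) ^ 2 ≤ 1 * (s + s) ^ 2 := by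
          gcongr; exact min_le_left _ _
      _ = s ^ 2 * 4 := by ring

theorem continuousOn_inv_add_sq {a t : ℝ} (ha : 0 < a) (ht : 0 < t) :
    ContinuousOn (fun s : ℝ ↦ 4 / (s + a) ^ 2) (uIcc 1 t) := by
  refine continuousOn_const.div (by fun_prop) fun s hs ↦ ?_
  have : 0 < s := (lt_min one_pos ht).trans_le hs.1
  positivity

theorem integral_inv_add_sq_le {a t : ℝ} (ha : 0 < a) (ht : 0 < t) :
    ∫ s in (1 : ℝ)..t, 4 / (s + a) ^ 2 ≤ 4 / a := by
  have h : ∀ s ∈ uIcc 1 t, HasDerivAt (fun s : ℝ ↦ -4 / (s + a)) (4 / (s + a) ^ 2) s := by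
    intro s hs
    have h0 : 0 < s := (lt_min one_pos ht).trans_le hs.1
    have := (((hasDerivAt_id s).add_const a).inv (by simp only [id]; positivity)).const_mul (-4)
    refine (this.congr_deriv ?_).congr_of_eventuallyEq (Filter.Eventually.of_forall fun x ↦ ?_)
    · simp only [id]; ring
    · simp only [id, Pi.inv_apply]; ring
  rw [intervalIntegral.integral_eq_sub_of_hasDerivAt h
    (continuousOn_inv_add_sq ha ht).intervalIntegrable]
  have h1 : 0 ≤ 4 / (t + a) := by positivity
  have h2 : 4 / (1 + a) ≤ 4 / a := by gcongr; linarith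
  have e1 : -4 / (t + a) = -(4 / (t + a)) := by ring
  have e2 : -4 / (1 + a) = -(4 / (1 + a)) := by ring
  linarith

theorem abs_sub_one_le_two_mul_abs_log {t : ℝ} (ht : 0 < t) (ht2 : t ≤ 2) :
    |t - 1| ≤ 2 * |Real.log t| := by
  rcases le_total t 1 with h | h
  · rw [abs_of_nonpos (by linarith), abs_of_nonpos (Real.log_nonpos ht.le h)]
    have := Real.log_le_sub_one_of_pos ht
    linarith
  · rw [abs_of_nonneg (by linarith), abs_of_nonneg (Real.log_nonneg h)]
    have := Real.one_sub_inv_le_log_of_pos ht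
    have h2 : (t - 1) ≤ 2 * (1 - t⁻¹) := by
      have : t * t⁻¹ = 1 := mul_inv_cancel₀ ht.ne'
      have h3 : 0 < t⁻¹ := inv_pos.2 ht
      nlinarith [mul_nonneg (sub_nonneg.2 h) (sub_nonneg.2 ht2)]
    linarith

/-! ### The trace of min(1, s²A²) -/

namespace FNSTrace

variable {H : Type*} [NormedAddCommGroup H] [InnerProductSpace ℂ H] [CompleteSpace H]
  {N : VonNeumannAlgebra H} (τ : FNSTrace N)

theorem toFun_cfc_mono {A : H →L[ℂ] H} (hA : A ∈ N) {φ ψ : ℝ → ℝ}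
    (hφ : ContinuousOn φ (spectrum ℝ A)) (hψ : ContinuousOn ψ (spectrum ℝ A))
    (h0 : ∀ x ∈ spectrum ℝ A, 0 ≤ φ x) (h : ∀ x ∈ spectrum ℝ A, φ x ≤ ψ x) :
    τ.toFun (cfc φ A) ≤ τ.toFun (cfc ψ A) :=
  τ.toFun_mono (cfc_real_mem hA _) (cfc_real_mem hA _) (cfc_nonneg h0) (cfc_mono h)

theorem toFun_cfc_const_mul {A : H →L[ℂ] H} (hA : A ∈ N) {c : ℝ} (hc : 0 ≤ c) {φ : ℝ → ℝ}
    (hφ : ContinuousOn φ (spectrum ℝ A)) (h0 : ∀ x ∈ spectrum ℝ A, 0 ≤ φ x) :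
    τ.toFun (cfc (fun x ↦ c * φ x) A) = ENNReal.ofReal c * τ.toFun (cfc φ A) := by
  rw [cfc_const_mul c φ A hφ, τ.toFun_real_smul hc (cfc_real_mem hA _) (cfc_nonneg h0)]

/-- `opFun_mul_estimate` with an explicit constant in the majorant. -/
theorem opFun_mul_estimate' {A B : H →L[ℂ] H} (hA : A ∈ N) (hA0 : 0 ≤ A) (hB : B ∈ N)
    {g : ℝ → ℂ} {φ : ℝ → ℝ} {C : ℝ} (hC : 0 ≤ C) (hg : ContinuousOn g (spectrum ℝ A))
    (hφ : ContinuousOn φ (spectrum ℝ A)) (h0 : ∀ x ∈ spectrum ℝ A, 0 ≤ φ x)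
    (hle : ∀ x ∈ spectrum ℝ A, ‖g x‖ ≤ C * φ x) (hfin : τ.toFun (cfc φ A) < ∞) :
    opFun g A * B ∈ τ.L1 ∧ τ.FiniteParts (ℜ (opFun g A * B) : H →L[ℂ] H) ∧
      τ.FiniteParts (ℑ (opFun g A * B) : H →L[ℂ] H) ∧
      ‖τ.tr (opFun g A * B)‖ ≤ 2 * (1 + ‖B‖ ^ 2) * (C * (τ.toFun (cfc φ A)).toReal) := by
  have e := τ.toFun_cfc_const_mul hA hC hφ h0
  have := τ.opFun_mul_estimate hA hA0 hB hg (hφ.const_mul C) hle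
    (by rw [e]; exact ENNReal.mul_lt_top ENNReal.ofReal_lt_top hfin)
  rwa [e, ENNReal.toReal_mul, ENNReal.toReal_ofReal hC] at this

/-- By normality it suffices to bound (min(1, s²A²) - ε)₊. This function vanishes once (sx)² ≤ ε, so
finitely many dyadic layers dominate it. -/
theorem toFun_cfc_min_le_sum {A : H →L[ℂ] H} (hA : A ∈ N) (hA0 : 0 ≤ A) {s : ℝ} (hs : 1 ≤ s)
    {W : ℝ≥0∞} (hW : ∀ K, ∑ k ∈ Finset.range (K + 1),
      ENNReal.ofReal (16 * min 1 (s ^ 2 / 4 ^ k)) * τ.dyadicTrace A k ≤ W) :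
    τ.toFun (cfc (fun x ↦ min 1 ((s * x) ^ 2)) A) ≤ W := by
  have hsp : ∀ x ∈ spectrum ℝ A, 0 ≤ x := fun x hx ↦ spectrum_nonneg_of_nonneg hA0 hx
  refine τ.toFun_le_of_forall_pos (cfc_real_mem hA _)
    (cfc_nonneg fun x _ ↦ le_min zero_le_one (sq_nonneg _)) fun ε hε ↦ ?_
  have hsmall : ∃ K : ℕ, (s * (4 / 2 ^ (K + 1))) ^ 2 ≤ ε := by
    have h1 : Filter.Tendsto (fun K : ℕ ↦ (s * (4 * (1 / 2 : ℝ) ^ (K + 1))) ^ 2) Filter.atTop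
        (nhds ((s * (4 * 0)) ^ 2)) :=
      ((((tendsto_pow_atTop_nhds_zero_of_lt_one (by norm_num) (by norm_num)).comp
        (Filter.tendsto_add_atTop_nat 1)).const_mul 4).const_mul s).pow 2
    have h2 := h1.eventually_lt_const (u := ε) (by simpa using hε)
    obtain ⟨K, hK⟩ := h2.exists
    refine ⟨K, le_of_eq_of_le ?_ hK.le⟩
    rw [one_div_pow]; ring
  obtain ⟨K, hK⟩ := hsmall
  refine le_trans ?_ (hW K)
  have hc : ∀ k, Continuous fun x ↦ dyadicCutoff k x ^ 2 :=
    fun k ↦ (continuous_dyadicCutoff k).pow 2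
  have hcm : ∀ k, Continuous fun x ↦ 16 * min 1 (s ^ 2 / 4 ^ k) * dyadicCutoff k x ^ 2 :=
    fun k ↦ (hc k).const_mul _
  have hpos : ∀ k, 0 ≤ 16 * min 1 (s ^ 2 / 4 ^ k) := fun k ↦ by positivity
  have e : ∑ k ∈ Finset.range (K + 1),
      ENNReal.ofReal (16 * min 1 (s ^ 2 / 4 ^ k)) * τ.dyadicTrace A k =
      τ.toFun (cfc (fun x ↦ ∑ k ∈ Finset.range (K + 1),
        16 * min 1 (s ^ 2 / 4 ^ k) * dyadicCutoff k x ^ 2) A) := by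
    rw [← Finset.sum_fn, cfc_sum (fun k x ↦ 16 * min 1 (s ^ 2 / 4 ^ k) * dyadicCutoff k x ^ 2) A _
      (fun k _ ↦ (hcm k).continuousOn), τ.toFun_sum _ _ (fun k _ ↦ cfc_real_mem hA _)
      (fun k _ ↦ cfc_nonneg fun x _ ↦ mul_nonneg (hpos k) (sq_nonneg _))]
    refine Finset.sum_congr rfl fun k _ ↦ ?_
    rw [τ.toFun_cfc_const_mul hA (hpos k) (hc k).continuousOn fun x _ ↦ sq_nonneg _]
    rfl
  rw [e, ← cfc_comp' (fun t : ℝ ↦ max (t - ε) 0) (fun x ↦ min 1 ((s * x) ^ 2)) A]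
  refine τ.toFun_cfc_mono hA (by fun_prop)
    (continuous_finsetSum _ fun k _ ↦ hcm k).continuousOn
    (fun x _ ↦ le_max_right _ _) fun x hx ↦ ?_
  have h0 : 0 ≤ ∑ k ∈ Finset.range (K + 1),
      16 * min 1 (s ^ 2 / 4 ^ k) * dyadicCutoff k x ^ 2 :=
    Finset.sum_nonneg fun k _ ↦ mul_nonneg (hpos k) (sq_nonneg _)
  refine max_le ?_ h0
  rcases le_or_min_le_sum_dyadicCutoff hs (hsp x hx) K with h | h
  · have h1 : min 1 ((s * x) ^ 2) ≤ ε := by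
      refine (min_le_right _ _).trans (le_trans ?_ hK)
      have := hsp x hx
      gcongr
    linarith
  · linarith

/-- Bound for `τ(min(1, s²A²))` in terms of the dyadic traces up to level `L`. -/
theorem toFun_cfc_min_le {A : H →L[ℂ] H} (hA : A ∈ N) (hA0 : 0 ≤ A) {D : ℝ} (hD : 0 ≤ D)
    (hfin : ∀ k, τ.dyadicTrace A k < ∞)
    (hDk : ∀ k : ℕ, (τ.dyadicTrace A k).toReal ≤ D * (k + 1) * 2 ^ k)
    {s : ℝ} (hs : 1 ≤ s) (L : ℕ) :
    τ.toFun (cfc (fun x ↦ min 1 ((s * x) ^ 2)) A) ≤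
      ENNReal.ofReal (16 * (∑ k ∈ Finset.range (L + 1),
        min 1 (s ^ 2 / 4 ^ k) * (τ.dyadicTrace A k).toReal + s ^ 2 * D * (L + 3) / 2 ^ L)) := by
  set n : ℕ → ℝ := fun k ↦ (τ.dyadicTrace A k).toReal with hn
  set a : ℕ → ℝ := fun k ↦ min 1 (s ^ 2 / 4 ^ k) * n k with ha
  have ha0 : ∀ k, 0 ≤ a k := fun k ↦ mul_nonneg (by positivity) ENNReal.toReal_nonneg
  -- The correction is the exact tail ∑_{k > j} (k + 1)/2ᵏ = (j + 3)/2ʲ at j = L + m, so each added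
  -- term is paid for by its decrease.
  have hstep : ∀ m : ℕ, ∑ k ∈ Finset.range (L + 1 + m), a k +
      s ^ 2 * D * (L + m + 3) / 2 ^ (L + m) ≤
      ∑ k ∈ Finset.range (L + 1), a k + s ^ 2 * D * (L + 3) / 2 ^ L := by
    intro m
    induction m with
    | zero => simp
    | succ m ih =>
      refine le_trans ?_ ih
      rw [← add_assoc, Finset.sum_range_succ, add_assoc]
      gcongr
      have h1 : a (L + 1 + m) ≤ s ^ 2 / 4 ^ (L + 1 + m) *
          (D * ((L + 1 + m : ℕ) + 1) * 2 ^ (L + 1 + m)) :=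
        mul_le_mul (min_le_right _ _) (hDk _) ENNReal.toReal_nonneg (by positivity)
      have h4 : (4 : ℝ) ^ (L + 1 + m) = 2 ^ (L + 1 + m) * 2 ^ (L + 1 + m) := by
        rw [← mul_pow]; norm_num
      have e1 : s ^ 2 / 4 ^ (L + 1 + m) * (D * ((L + 1 + m : ℕ) + 1) * 2 ^ (L + 1 + m)) =
          s ^ 2 * D * (L + m + 2) / 2 ^ (L + m + 1) := by
        rw [h4, show L + 1 + m = L + m + 1 by ring]
        push_cast
        field_simp
        ring
      rw [e1] at h1
      refine (add_le_add_left h1 _).trans (le_of_eq ?_)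
      rw [← add_assoc L m 1, pow_succ]
      push_cast
      field_simp
      ring
  refine τ.toFun_cfc_min_le_sum hA hA0 hs fun K ↦ ?_
  have e : ∑ k ∈ Finset.range (K + 1),
      ENNReal.ofReal (16 * min 1 (s ^ 2 / 4 ^ k)) * τ.dyadicTrace A k =
      ENNReal.ofReal (16 * ∑ k ∈ Finset.range (K + 1), a k) := by
    rw [Finset.mul_sum, ENNReal.ofReal_sum_of_nonneg fun k _ ↦ mul_nonneg (by norm_num) (ha0 k)]
    refine Finset.sum_congr rfl fun k _ ↦ ?_
    rw [← ENNReal.ofReal_toReal (hfin k).ne, ← ENNReal.ofReal_mul (by positivity), mul_assoc]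
  rw [e]
  refine ENNReal.ofReal_le_ofReal (mul_le_mul_of_nonneg_left ?_ (by norm_num))
  refine le_trans ?_ (hstep K)
  refine le_trans (Finset.sum_le_sum_of_subset_of_nonneg ?_ fun k _ _ ↦ ha0 k)
    (le_add_of_nonneg_right (by positivity))
  exact Finset.range_subset_range.2 (by lia)

end FNSTrace

namespace FNSTrace

variable {H : Type*} [NormedAddCommGroup H] [InnerProductSpace ℂ H] [CompleteSpace H]
  {N : VonNeumannAlgebra H} (τ : FNSTrace N)

theorem exists_spectrum_subset_Icc {A : H →L[ℂ] H} (hA0 : 0 ≤ A) :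
    ∃ R : ℝ, 0 ≤ R ∧ ∀ x ∈ spectrum ℝ A, 0 ≤ x ∧ x ≤ R := by
  obtain ⟨R, hR⟩ := (ContinuousFunctionalCalculus.isCompact_spectrum (R := ℝ)
    (p := IsSelfAdjoint) A).isBounded.exists_norm_le
  refine ⟨max R 0, le_max_right _ _, fun x hx ↦ ⟨spectrum_nonneg_of_nonneg hA0 hx, ?_⟩⟩
  exact (Real.le_norm_self x).trans ((hR x hx).trans (le_max_left _ _))

/-- On a spectrum inside [0, R] one has x² ≤ (1 + R²) min(1, x²), which reduces to the case s = 1.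
-/
theorem toFun_cfc_sq_lt_top {A : H →L[ℂ] H} (hA : A ∈ τ.M1Infty) (hA0 : 0 ≤ A) :
    τ.toFun (cfc (fun x : ℝ ↦ x ^ 2) A) < ∞ := by
  obtain ⟨D, hD, hfin, hDk, -⟩ := τ.exists_dyadicTrace_bound hA hA0
  obtain ⟨R, hR, hsp⟩ := exists_spectrum_subset_Icc hA0
  have h := τ.toFun_cfc_min_le hA.1 hA0 hD hfin hDk le_rfl 0
  have e := τ.toFun_cfc_const_mul (A := A) hA.1 (c := 1 + R ^ 2) (by positivity)
    (φ := fun x ↦ min 1 ((1 * x) ^ 2)) (by fun_prop)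
    (fun x _ ↦ le_min zero_le_one (sq_nonneg _))
  refine lt_of_le_of_lt (τ.toFun_cfc_mono hA.1 (ψ := fun x ↦ (1 + R ^ 2) * min 1 ((1 * x) ^ 2))
    (by fun_prop) (by fun_prop) (fun x _ ↦ sq_nonneg _) fun x hx ↦ ?_) ?_
  · obtain ⟨h0, h1⟩ := hsp x hx
    rw [one_mul]
    rcases le_total x 1 with h | h
    · rw [min_eq_right (pow_le_one₀ h0 h)]
      nlinarith [mul_nonneg (sq_nonneg R) (sq_nonneg x)]
    · rw [min_eq_left (one_le_pow₀ h)]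
      nlinarith
  · rw [e]
    exact ENNReal.mul_lt_top ENNReal.ofReal_lt_top (h.trans_lt ENNReal.ofReal_lt_top)

end FNSTrace

/-! ### The heat function and its logarithmic mean -/

section Heat

variable {H : Type*} [NormedAddCommGroup H] [InnerProductSpace ℂ H] [CompleteSpace H]
  {N : VonNeumannAlgebra H} (τ : FNSTrace N) {f : ℝ → ℂ} {A B : H →L[ℂ] H}

theorem continuousOn_comp_mul_spectrum (hf : ContinuousOn f (Ici 0)) (hA0 : 0 ≤ A) {s : ℝ}
    (hs : 0 ≤ s) : ContinuousOn (fun x ↦ f (s * x)) (spectrum ℝ A) :=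
  hf.comp (by fun_prop) fun _ hx ↦ mul_nonneg hs (spectrum_nonneg_of_nonneg hA0 hx)

theorem opFun_smul_of_nonneg (hf : ContinuousOn f (Ici 0)) (hA0 : 0 ≤ A) {s : ℝ} (hs : 0 ≤ s) :
    opFun f ((s : ℂ) • A) = opFun (fun x ↦ f (s * x)) A := by
  refine opFun_smul hA0.isSelfAdjoint s (hf.mono ?_)
  rintro _ ⟨x, hx, rfl⟩
  exact mul_nonneg hs (spectrum_nonneg_of_nonneg hA0 hx)

/-- `s ↦ τ(f(sA)B)` is continuous on `(0,∞)`. -/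
theorem continuousOn_tr_opFun_smul_mul (hf : ContDiffOn ℝ 2 f (Ici 0)) (hf0 : f 0 = 0)
    (hf'0 : derivWithin f (Ici 0) 0 = 0) (hA : A ∈ τ.M1Infty) (hA0 : 0 ≤ A) (hB : B ∈ N) :
    ContinuousOn (fun s : ℝ ↦ τ.tr (opFun f ((s : ℂ) • A) * B)) (Ioi 0) := by
  obtain ⟨R, hR, hsp⟩ := FNSTrace.exists_spectrum_subset_Icc hA0
  have hsa : IsSelfAdjoint A := hA0.isSelfAdjoint
  have hfin := τ.toFun_cfc_sq_lt_top hA hA0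
  have hlip : ∀ M : ℝ, 0 < M → ContinuousOn (fun s : ℝ ↦ τ.tr (opFun f ((s : ℂ) • A) * B))
      (Ioo 0 M) := by
    intro M hM
    obtain ⟨C, hC, hCf⟩ := exists_norm_sub_le_mul_max hf hf'0 (M * R)
    have hdiff : ∀ s s' : ℝ, 0 ≤ s → 0 ≤ s' → s ≤ M → s' ≤ M → ∀ x ∈ spectrum ℝ A,
        ‖f (s * x) - f (s' * x)‖ ≤ C * M * |s - s'| * x ^ 2 := by
      intro s s' hs hs' hsM hsM' x hx
      obtain ⟨h0, h1⟩ := hsp x hx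
      refine (hCf (s * x) (s' * x) (M * x) (by positivity) (by positivity) (by gcongr)
        (by gcongr) (by gcongr)).trans (le_of_eq ?_)
      rw [← sub_mul, abs_mul, abs_of_nonneg h0]
      ring
    have hcont := fun (s : ℝ) (hs : 0 ≤ s) ↦ continuousOn_comp_mul_spectrum hf.continuousOn hA0 hs
    -- Comparison with s' = 0, where f vanishes, supplies the finiteness that linearity of the trace
    -- requires.
    have hparts : ∀ s : ℝ, 0 ≤ s → s ≤ M →
        τ.FiniteParts (ℜ (opFun (fun x ↦ f (s * x)) A * B) : H →L[ℂ] H) ∧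
        τ.FiniteParts (ℑ (opFun (fun x ↦ f (s * x)) A * B) : H →L[ℂ] H) := by
      intro s hs hsM
      have := τ.opFun_mul_estimate' hA.1 hA0 hB (C := C * M * |s - 0|) (by positivity) (hcont s hs)
        (φ := fun x ↦ x ^ 2) (by fun_prop) (fun x _ ↦ sq_nonneg x) (fun x hx ↦ by
          have := hdiff s 0 hs le_rfl hsM hM.le x hx
          rwa [zero_mul, hf0, sub_zero] at this) hfin
      exact ⟨this.2.1, this.2.2.1⟩
    set T := (τ.toFun (cfc (fun x : ℝ ↦ x ^ 2) A)).toReal with hT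
    refine LipschitzOnWith.continuousOn (K := Real.toNNReal (2 * (1 + ‖B‖ ^ 2) * (C * M * T)))
      (LipschitzOnWith.of_dist_le_mul fun s hs s' hs' ↦ ?_)
    have hT0 : 0 ≤ T := ENNReal.toReal_nonneg
    rw [Real.coe_toNNReal _ (by positivity), dist_eq_norm, Real.dist_eq,
      opFun_smul_of_nonneg hf.continuousOn hA0 hs.1.le,
      opFun_smul_of_nonneg hf.continuousOn hA0 hs'.1.le,
      ← FNSTrace.tr_sub (mul_mem (opFun_mem hA.1 _) hB) (mul_mem (opFun_mem hA.1 _) hB)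
        (hparts s hs.1.le hs.2.le).1 (hparts s hs.1.le hs.2.le).2
        (hparts s' hs'.1.le hs'.2.le).1 (hparts s' hs'.1.le hs'.2.le).2,
      ← sub_mul, ← opFun_sub hsa (hcont s hs.1.le) (hcont s' hs'.1.le)]
    refine (τ.opFun_mul_estimate' hA.1 hA0 hB (C := C * M * |s - s'|) (by positivity)
      ((hcont s hs.1.le).sub (hcont s' hs'.1.le))
      (φ := fun x ↦ x ^ 2) (by fun_prop) (fun x _ ↦ sq_nonneg x)
      (hdiff s s' hs.1.le hs'.1.le hs.2.le hs'.2.le) hfin).2.2.2.trans (le_of_eq ?_)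
    ring
  intro s hs
  have hs0 : (0 : ℝ) < s := hs
  exact ((hlip (s + 1) (by linarith)).continuousAt
    (Ioo_mem_nhds hs0 (by linarith))).continuousWithinAt

theorem heatFun_div (s : ℝ) :
    heatFun τ f A B s / (s : ℂ) = τ.tr (opFun f ((s : ℂ) • A) * B) / (s : ℂ) ^ 2 := by
  rw [heatFun]
  by_cases hs : (s : ℂ) = 0
  · simp [hs]
  · field_simp

theorem norm_heatFun_div {s : ℝ} :
    ‖heatFun τ f A B s / (s : ℂ)‖ = ‖τ.tr (opFun f ((s : ℂ) • A) * B)‖ / s ^ 2 := by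
  rw [heatFun_div, norm_div, norm_pow, Complex.norm_real, Real.norm_eq_abs, sq_abs]

theorem continuousOn_heatFun_div (hf : ContDiffOn ℝ 2 f (Ici 0)) (hf0 : f 0 = 0)
    (hf'0 : derivWithin f (Ici 0) 0 = 0) (hA : A ∈ τ.M1Infty) (hA0 : 0 ≤ A) (hB : B ∈ N) :
    ContinuousOn (fun s : ℝ ↦ heatFun τ f A B s / (s : ℂ)) (Ioi 0) := by
  simp only [heatFun_div]
  refine (continuousOn_tr_opFun_smul_mul τ hf hf0 hf'0 hA hA0 hB).div (by fun_prop) fun s hs ↦ ?_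
  have : (s : ℂ) ≠ 0 := by exact_mod_cast (ne_of_gt hs)
  exact pow_ne_zero 2 this

theorem uIcc_one_subset_Ioi {t : ℝ} (ht : 0 < t) : uIcc 1 t ⊆ Ioi 0 :=
  fun _ hs ↦ (lt_min one_pos ht).trans_le hs.1

theorem norm_cesaro_le_of_integral_le {x : ℝ → ℂ} {t K : ℝ} (hK : 0 ≤ K)
    (h : ‖∫ s in (1 : ℝ)..t, x s / (s : ℂ)‖ ≤ K * |Real.log t|) : ‖cesaro x t‖ ≤ K := by
  rw [cesaro, norm_mul, norm_div, norm_one, Complex.norm_real, Real.norm_eq_abs,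
    one_div_mul_eq_div]
  -- This form needs only |log t| ≥ 0, so it covers t = 1, where the quotient is 0.
  exact div_le_of_le_mul₀ (abs_nonneg _) hK h

theorem aestronglyMeasurable_cesaro {x : ℝ → ℂ}
    (hx : ContinuousOn (fun s : ℝ ↦ x s / (s : ℂ)) (Ioi 0)) :
    AEStronglyMeasurable (cesaro x) (volume.restrict (Ioi 0)) := by
  have h1 : ContinuousOn (fun t : ℝ ↦ ∫ s in (1 : ℝ)..t, x s / (s : ℂ)) (Ioi 0) := by
    intro t ht
    have hd := intervalIntegral.integral_hasDerivAt_right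
      ((hx.mono (uIcc_one_subset_Ioi ht)).intervalIntegrable)
      (hx.stronglyMeasurableAtFilter isOpen_Ioi t ht) (hx.continuousAt (Ioi_mem_nhds ht))
    exact hd.continuousAt.continuousWithinAt
  refine AEStronglyMeasurable.mul (Measurable.aestronglyMeasurable ?_)
    (h1.aestronglyMeasurable measurableSet_Ioi)
  fun_prop

/-- The main growth estimate `∫₁ᵗ |x(s)| ds/s = O(log t)`. -/
theorem exists_norm_integral_heatFun_div_le (hf : ContDiffOn ℝ 2 f (Ici 0))
    (hbdd : ∃ K : ℝ, ∀ t : ℝ, 0 ≤ t → ‖f t‖ ≤ K) (hf0 : f 0 = 0)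
    (hf'0 : derivWithin f (Ici 0) 0 = 0) (hA : A ∈ τ.M1Infty) (hA0 : 0 ≤ A) (hB : B ∈ N) :
    ∃ K : ℝ, 0 ≤ K ∧ ∀ t : ℝ, 0 < t →
      ‖∫ s in (1 : ℝ)..t, heatFun τ f A B s / (s : ℂ)‖ ≤ K * |Real.log t| := by
  obtain ⟨C, hC, hCf⟩ := exists_norm_le_mul_min hf hbdd hf0 hf'0
  obtain ⟨D, hD, hfin, hDk, hDs⟩ := τ.exists_dyadicTrace_bound hA hA0
  have hsp : ∀ x ∈ spectrum ℝ A, 0 ≤ x := fun x hx ↦ spectrum_nonneg_of_nonneg hA0 hx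
  have hcont := fun (s : ℝ) (hs : 0 ≤ s) ↦ continuousOn_comp_mul_spectrum hf.continuousOn hA0 hs
  have hfin2 := τ.toFun_cfc_sq_lt_top hA hA0
  set b : ℝ := 2 * (1 + ‖B‖ ^ 2) * C with hb
  have hb0 : 0 ≤ b := by positivity
  set T := (τ.toFun (cfc (fun x : ℝ ↦ x ^ 2) A)).toReal with hT
  have hT0 : 0 ≤ T := ENNReal.toReal_nonneg
  -- The quadratic bound on f produces a factor s² that cancels 1/s².
  have hsmall : ∀ s : ℝ, 0 < s → ‖heatFun τ f A B s / (s : ℂ)‖ ≤ b * T := by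
    intro s hs
    rw [norm_heatFun_div, opFun_smul_of_nonneg hf.continuousOn hA0 hs.le,
      div_le_iff₀ (by positivity)]
    refine (τ.opFun_mul_estimate' hA.1 hA0 hB (C := C * s ^ 2) (by positivity) (hcont s hs.le)
      (φ := fun x ↦ x ^ 2) (by fun_prop) (fun x _ ↦ sq_nonneg x) (fun x hx ↦ ?_)
      hfin2).2.2.2.trans (le_of_eq (by rw [hb]; ring))
    refine (hCf _ (mul_nonneg hs.le (hsp x hx))).trans ?_
    rw [mul_assoc, ← mul_pow]
    exact mul_le_mul_of_nonneg_left (min_le_right _ _) hC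
  set n : ℕ → ℝ := fun k ↦ (τ.dyadicTrace A k).toReal with hn
  have hn0 : ∀ k, 0 ≤ n k := fun k ↦ ENNReal.toReal_nonneg
  set h : ℕ → ℝ → ℝ := fun L s ↦ b * 16 * (∑ k ∈ Finset.range (L + 1),
    n k * (4 / (s + 2 ^ k) ^ 2) + D * (L + 3) / 2 ^ L) with hh
  have hlarge : ∀ (L : ℕ) (s : ℝ), 1 ≤ s → ‖heatFun τ f A B s / (s : ℂ)‖ ≤ h L s := by
    intro L s hs
    have hs0 : 0 < s := one_pos.trans_le hs
    have hle := τ.toFun_cfc_min_le hA.1 hA0 hD hfin hDk hs L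
    have hR := ENNReal.toReal_mono ENNReal.ofReal_ne_top hle
    rw [ENNReal.toReal_ofReal (by positivity)] at hR
    rw [norm_heatFun_div, opFun_smul_of_nonneg hf.continuousOn hA0 hs0.le,
      div_le_iff₀ (by positivity)]
    refine (τ.opFun_mul_estimate' hA.1 hA0 hB hC (hcont s hs0.le)
      (φ := fun x ↦ min 1 ((s * x) ^ 2)) (by fun_prop)
      (fun x _ ↦ le_min zero_le_one (sq_nonneg _))
      (fun x hx ↦ hCf _ (mul_nonneg hs0.le (hsp x hx)))
      (hle.trans_lt ENNReal.ofReal_lt_top)).2.2.2.trans ?_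
    rw [← mul_assoc, ← hb, hh]
    simp only
    rw [mul_assoc b 16, mul_assoc b]
    refine mul_le_mul_of_nonneg_left (hR.trans ?_) hb0
    rw [mul_assoc (16 : ℝ), add_mul, Finset.sum_mul]
    gcongr 16 * (∑ k ∈ _, ?_ + ?_) with k hk
    · have h1 := min_one_div_le hs0 (pow_pos (two_pos (α := ℝ)) k)
      have h2 : ((2 : ℝ) ^ k) ^ 2 = 4 ^ k := by
        rw [← pow_mul, mul_comm, pow_mul]; norm_num
      rw [h2] at h1
      calc _ ≤ s ^ 2 * (4 / (s + 2 ^ k) ^ 2) * n k := mul_le_mul_of_nonneg_right h1 (hn0 k)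
        _ = _ := by ring
    · exact le_of_eq (by ring)
  -- The layers give 4D(L + 1) and the tail 2D(L + 3), as (t - 1)/2^L ≤ 2; the sum is at most 10D(L
  -- + 1).
  have hint : ∀ (L : ℕ) (t : ℝ), 1 ≤ t → t ≤ 2 ^ (L + 1) →
      ‖∫ s in (1 : ℝ)..t, heatFun τ f A B s / (s : ℂ)‖ ≤ b * 16 * (10 * D * (L + 1)) := by
    intro L t ht htL
    have ht0 : 0 < t := one_pos.trans_le ht
    have hk : ∀ k : ℕ, (0 : ℝ) < 2 ^ k := fun k ↦ by positivity
    have hi : ∀ k : ℕ, IntervalIntegrable (fun s : ℝ ↦ n k * (4 / (s + 2 ^ k) ^ 2)) volume 1 t :=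
      fun k ↦ ((continuousOn_inv_add_sq (hk k) ht0).intervalIntegrable).const_mul _
    have his : IntervalIntegrable (fun s : ℝ ↦ ∑ k ∈ Finset.range (L + 1),
        n k * (4 / (s + 2 ^ k) ^ 2)) volume 1 t := by
      have := IntervalIntegrable.sum (Finset.range (L + 1)) (fun k _ ↦ hi k)
      rwa [Finset.sum_fn] at this
    refine (intervalIntegral.norm_integral_le_of_norm_le (g := h L) ht
      (Filter.Eventually.of_forall fun s hs ↦ hlarge L s hs.1.le)
      ((his.add intervalIntegrable_const).const_mul _)).trans ?_
    rw [hh]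
    simp only
    rw [intervalIntegral.integral_const_mul, intervalIntegral.integral_add his
      intervalIntegrable_const, intervalIntegral.integral_finsetSum fun k _ ↦ hi k,
      intervalIntegral.integral_const, smul_eq_mul]
    refine mul_le_mul_of_nonneg_left ?_ (by positivity)
    have h1 : ∑ k ∈ Finset.range (L + 1), ∫ s in (1 : ℝ)..t, n k * (4 / (s + 2 ^ k) ^ 2) ≤
        4 * (D * (L + 1)) := by
      refine le_trans ?_ (mul_le_mul_of_nonneg_left (hDs L) (by norm_num))
      rw [Finset.mul_sum]
      refine Finset.sum_le_sum fun k _ ↦ ?_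
      rw [intervalIntegral.integral_const_mul]
      refine (mul_le_mul_of_nonneg_left (integral_inv_add_sq_le (hk k) ht0) (hn0 k)).trans
        (le_of_eq ?_)
      rw [hn]; ring
    have h2 : (t - 1) * (D * (L + 3) / 2 ^ L) ≤ 2 * (D * (L + 3)) := by
      calc (t - 1) * (D * (L + 3) / 2 ^ L) ≤ 2 ^ (L + 1) * (D * (L + 3) / 2 ^ L) := by
            gcongr; linarith
        _ = 2 * (D * (L + 3)) := by rw [pow_succ]; field_simp
    have h3 : 0 ≤ D * L := by positivity
    linarith
  set K := max (b * T * 2) (b * 16 * (10 * D * 4)) with hK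
  refine ⟨K, le_max_of_le_left (by positivity), fun t ht ↦ ?_⟩
  rcases le_or_gt t 2 with ht2 | ht2
  · have h1 := intervalIntegral.norm_integral_le_of_norm_le_const (a := 1) (b := t)
      (f := fun s : ℝ ↦ heatFun τ f A B s / (s : ℂ)) (C := b * T)
      fun s hs ↦ hsmall s (uIcc_one_subset_Ioi ht (uIoc_subset_uIcc hs))
    calc _ ≤ b * T * |t - 1| := h1
      _ ≤ b * T * (2 * |Real.log t|) := by
        gcongr; exact abs_sub_one_le_two_mul_abs_log ht ht2
      _ = b * T * 2 * |Real.log t| := by ring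
      _ ≤ K * |Real.log t| := by gcongr; exact le_max_left _ _
  · obtain ⟨L, hL1, hL2⟩ := exists_nat_pow_near (by linarith : (1 : ℝ) ≤ t) (one_lt_two)
    have hlog0 : 0 ≤ Real.log t := Real.log_nonneg (by linarith)
    rw [abs_of_nonneg hlog0]
    have hL0 : L ≠ 0 := by
      rintro rfl
      norm_num at hL2
      linarith
    have hL : (1 : ℝ) ≤ L := by exact_mod_cast Nat.one_le_iff_ne_zero.2 hL0
    -- From L ≥ 1 and 2^L ≤ t: L + 1 ≤ 2L ≤ 2 log t / log 2, and log 2 > 1/2.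
    have hlog : (L + 1 : ℝ) ≤ 4 * Real.log t := by
      have h1 := Real.log_le_log (by positivity) hL1
      rw [Real.log_pow] at h1
      have h2 := Real.log_two_gt_d9
      nlinarith
    calc _ ≤ b * 16 * (10 * D * (L + 1)) := hint L t (by linarith) hL2.le
      _ ≤ b * 16 * (10 * D * (4 * Real.log t)) := by gcongr
      _ = b * 16 * (10 * D * 4) * Real.log t := by ring
      _ ≤ K * Real.log t := by gcongr; exact le_max_right _ _

end Heat

theorem mainTheorem10 {H : Type*} [NormedAddCommGroup H] [InnerProductSpace ℂ H] [CompleteSpace H]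
    (N : VonNeumannAlgebra H) (τ : FNSTrace N)
    (f : ℝ → ℂ) (hf : ContDiffOn ℝ 2 f (Ici 0)) (hbdd : ∃ K : ℝ, ∀ t : ℝ, 0 ≤ t → ‖f t‖ ≤ K)
    (hf0 : f 0 = 0) (hf'0 : derivWithin f (Ici 0) 0 = 0)
    (A B : H →L[ℂ] H) (hA : A ∈ τ.M1Infty) (hApos : 0 ≤ A) (hB : B ∈ N) :
    (∀ t : ℝ, 0 < t → opFun f ((t : ℂ) • A) * B ∈ τ.L1) ∧
      CesaroDomain (heatFun τ f A B) ∧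
      cesaro (heatFun τ f A B) ∈ LInfty := by
  have hcont := continuousOn_heatFun_div τ hf hf0 hf'0 hA hApos hB
  obtain ⟨K, hK, hKt⟩ := exists_norm_integral_heatFun_div_le τ hf hbdd hf0 hf'0 hA hApos hB
  refine ⟨fun t ht ↦ ?_, fun t ht ↦ ?_, aestronglyMeasurable_cesaro hcont, K, fun t ht ↦
    norm_cesaro_le_of_integral_le hK (hKt t ht)⟩
  · obtain ⟨C, hC, hCf⟩ := exists_norm_le_mul_min hf hbdd hf0 hf'0
    rw [opFun_smul_of_nonneg hf.continuousOn hApos ht.le]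
    refine (τ.opFun_mul_estimate' hA.1 hApos hB (C := C * t ^ 2) (by positivity)
      (continuousOn_comp_mul_spectrum hf.continuousOn hApos ht.le)
      (φ := fun x ↦ x ^ 2) (by fun_prop) (fun x _ ↦ sq_nonneg x) (fun x hx ↦ ?_)
      (τ.toFun_cfc_sq_lt_top hA hApos)).1
    refine (hCf _ (mul_nonneg ht.le (spectrum_nonneg_of_nonneg hApos hx))).trans ?_
    rw [mul_assoc, ← mul_pow]
    exact mul_le_mul_of_nonneg_left (min_le_right _ _) hC
  · exact (hcont.mono (uIcc_one_subset_Ioi ht)).intervalIntegrable
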